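/- A foliation $\mathcal F$ of degree $d$ on $\mathbb P^2_{\mathbb C}$ is given, up to a nonzero constant factor, by a $1$-form $\omega=a\,dx+b\,dy+c\,dz$ with $a,b,c\in\mathbb C[x,y,z]$ homogeneous of degree $d+1$, without common factor and satisfying $xa+yb+zc=0$. It is homogeneous if in some affine chart it is invariant under all homotheties $(x,y)\mapsto\lambda(x,y)$, $\lambda\in\mathbb C^*$. It is convex if its inflection divisor, with equation $\det\big(R,\,Z,\,Z(Z)\big)=0$, is a product of $\mathcal F$-invariant lines; here $R=(x,y,z)$, $Z=(E,F,G)$ is a homogeneous vector field of degree $d$ with $\omega=i_Ri_Z(dx\wedge dy\wedge dz)$ and $Z(Z)=(Z(E),Z(F),Z(G))$. A singularity $s$ of $\mathcal F$ is radial of order $k\ge1$ if $\mathcal F$ has vanishing order $1$ at $s$ and tangency order $k+1$ with the generic line through $s$. The type of a homogeneous foliation of degree $d$ is the formal sum $\sum_{k=1}^{d-1}(r_k\mathrm R_k+t_k\mathrm T_k)$, where $r_k$ is the number of its radial singularities of order $k$ and $t_k$ the number of its transverse inflection lines of order $k$ (non-invariant lines of multiplicity $k$ in the inflection divisor). Theorem.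 Up to automorphisms of $\mathbb P^2_{\mathbb C}$ there are exactly five homogeneous convex foliations $\mathcal H_1,\dots,\mathcal H_5$ of degree $4$ on $\mathbb P^2_{\mathbb C}$. They are respectively described in an affine chart $(x,y)$ by the $1$-forms \begin{align*} \omega_1&=y^4\,dx-x^4\,dy,\\ \omega_2&=y^3(2x-y)\,dx+x^3(x-2y)\,dy,\\ \omega_3&=y^2(6x^2+4xy+y^2)\,dx-x^3(x+4y)\,dy,\\ \omega_4&=y^3(4x+y)\,dx+x^3(x+4y)\,dy,\\ \omega_5&=y^2(6x^2+4xy+y^2)\,dx+3x^4\,dy, \end{align*} and their types are respectively $2\mathrm R_3$, $3\mathrm R_2$, $\mathrm R_1+\mathrm R_2+\mathrm R_3$, $2\mathrm R_1+2\mathrm R_2$ and $3\mathrm R_1+\mathrm R_3$. That is, each $\mathcal H_i$ is homogeneous and convex, of the stated type, every homogeneous convex foliation of degree $4$ is conjugate to some $\mathcal H_i$ by an automorphism of $\mathbb P^2_{\mathbb C}$, and $\mathcal H_1,\dots,\mathcal H_5$ are pairwise non-conjugate. -/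

import Mathlib

noncomputable section

namespace PlaneFoliation

open MvPolynomial
open scoped Matrix LinearAlgebra.Projectivization

/-- A homogeneous `1`-form `a dx + b dy + c dz` on `ℂ³` defining a foliation of degree `d` on the
complex projective plane: `a = coeff 0`, `b = coeff 1`, `c = coeff 2` are homogeneous of degree
`d + 1`, have no common factor, and satisfy the Euler condition `x a + y b + z c = 0`. -/
structure FoliationForm (d : ℕ) where
  coeff : Fin 3 → MvPolynomial (Fin 3) ℂ
  homogeneous : ∀ i, (coeff i).IsHomogeneous (d + 1)
  euler : ∑ i, X i * coeff i = 0
  coprime : ∀ p : MvPolynomial (Fin 3) ℂ, (∀ i, p ∣ coeff i) → IsUnit p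

/-- Two forms define the same foliation when they differ by a nonzero constant factor. -/
instance formSetoid (d : ℕ) : Setoid (FoliationForm d) where
  r ω η := ∃ k : ℂ, k ≠ 0 ∧ ∀ i, η.coeff i = C k * ω.coeff i
  iseqv :=
    { refl := fun ω => ⟨1, one_ne_zero, fun i => by simp⟩
      symm := by
        rintro ω η ⟨k, hk, h⟩
        refine ⟨k⁻¹, inv_ne_zero hk, fun i => ?_⟩
        rw [h i, ← mul_assoc, ← C_mul, inv_mul_cancel₀ hk, C_1, one_mul]
      trans := by
        rintro ω η θ ⟨k, hk, h⟩ ⟨l, hl, h'⟩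
        refine ⟨l * k, mul_ne_zero hl hk, fun i => ?_⟩
        rw [h' i, h i, ← mul_assoc, ← C_mul] }

/-- The set `F(d)` of foliations of degree `d` on the complex projective plane. -/
def Foliation (d : ℕ) : Type := Quotient (formSetoid d)

/-! ### The action of the automorphism group of the projective plane -/

/-- The substitution `p(v) ↦ p(g v)`. -/
def subst (g : Matrix (Fin 3) (Fin 3) ℂ) :
    MvPolynomial (Fin 3) ℂ →ₐ[ℂ] MvPolynomial (Fin 3) ℂ :=
  aeval (fun i => ∑ j, C (g i j) * X j)

theorem subst_subst (g h : Matrix (Fin 3) (Fin 3) ℂ) (p : MvPolynomial (Fin 3) ℂ) :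
    subst g (subst h p) = subst (h * g) p := by
  have : (subst g).comp (subst h) = subst (h * g) := by
    apply MvPolynomial.algHom_ext
    intro i
    simp only [subst, AlgHom.comp_apply, aeval_X, map_sum, map_mul, Matrix.mul_apply,
      Finset.mul_sum, Finset.sum_mul, algHom_C, algebraMap_eq]
    rw [Finset.sum_comm]
    simp only [mul_assoc]
  exact DFunLike.congr_fun this p

theorem subst_one (p : MvPolynomial (Fin 3) ℂ) : subst 1 p = p := by
  have : subst 1 = AlgHom.id ℂ (MvPolynomial (Fin 3) ℂ) := by
    apply MvPolynomial.algHom_ext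
    intro i
    simp [subst, Matrix.one_apply]
  exact DFunLike.congr_fun this p

/-- The coefficients of the pullback `g^* ω`, obtained from `x_i ↦ ∑ j, g i j x_j` and
`dx_i ↦ ∑ j, g i j dx_j`. -/
def pullbackCoeff (g : Matrix (Fin 3) (Fin 3) ℂ) (a : Fin 3 → MvPolynomial (Fin 3) ℂ) (j : Fin 3) :
    MvPolynomial (Fin 3) ℂ :=
  ∑ i, C (g i j) * subst g (a i)

/-- The pullback of a form by a linear automorphism of `ℂ³`. -/
def FoliationForm.pullback {d : ℕ} (g : GL (Fin 3) ℂ) (ω : FoliationForm d) : FoliationForm d where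
  coeff := pullbackCoeff g.val ω.coeff
  homogeneous j := by
    refine IsHomogeneous.sum _ _ _ fun i _ => ?_
    refine IsHomogeneous.C_mul ?_ _
    have := (ω.homogeneous i).aeval (fun i => ∑ j, C (g.val i j) * (X j : MvPolynomial (Fin 3) ℂ))
      (n := 1) (fun i => IsHomogeneous.sum _ _ _ fun j _ => (isHomogeneous_X _ _).C_mul _)
    simpa [subst] using this
  euler := by
    have h := congrArg (subst g.val) ω.euler
    simp only [map_sum, map_mul, map_zero] at h
    rw [← h]
    simp only [pullbackCoeff, Finset.mul_sum]
    rw [Finset.sum_comm]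
    refine Finset.sum_congr rfl fun i _ => ?_
    rw [show subst g.val (X i) = ∑ j, C (g.val i j) * X j by simp [subst], Finset.sum_mul]
    exact Finset.sum_congr rfl fun j _ => by ring
  coprime p hp := by
    have hgg : g.val * g⁻¹.val = 1 := g.mul_inv
    have hgg' : g⁻¹.val * g.val = 1 := g.inv_mul
    have key : ∀ i, p ∣ subst g.val (ω.coeff i) := by
      intro i
      have : subst g.val (ω.coeff i)
          = ∑ j, C (g⁻¹.val j i) * pullbackCoeff g.val ω.coeff j := by
        simp only [pullbackCoeff, Finset.mul_sum]
        rw [Finset.sum_comm]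
        have h1 : ∀ k, ∑ j, C (g⁻¹.val j i) * (C (g.val k j) * subst g.val (ω.coeff k))
            = C ((g.val * g⁻¹.val) k i) * subst g.val (ω.coeff k) := by
          intro k
          rw [Matrix.mul_apply, map_sum, Finset.sum_mul]
          refine Finset.sum_congr rfl fun j _ => ?_
          rw [C_mul]
          ring
        rw [Finset.sum_congr rfl fun k _ => h1 k, hgg]
        simp [Matrix.one_apply]
      rw [this]
      exact Finset.dvd_sum fun j _ => (hp j).mul_left _
    have hu : IsUnit (subst g⁻¹.val p) := by
      refine ω.coprime _ fun i => ?_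
      have h2 := map_dvd (subst g⁻¹.val) (key i)
      rwa [subst_subst, hgg, subst_one] at h2
    have h3 := hu.map (subst g.val)
    rwa [subst_subst, hgg', subst_one] at h3

/-- The pullback of a foliation by the automorphism of the projective plane induced by `g`. -/
def Foliation.pullback {d : ℕ} (g : GL (Fin 3) ℂ) : Foliation d → Foliation d :=
  Quotient.map (FoliationForm.pullback g) (by
    rintro ω η ⟨k, hk, h⟩
    refine ⟨k, hk, fun j => ?_⟩
    simp only [FoliationForm.pullback, pullbackCoeff, Finset.mul_sum]
    refine Finset.sum_congr rfl fun i _ => ?_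
    rw [h i, map_mul, show subst g.val (C k) = C k by simp [subst]]
    ring)

/-- Two foliations are conjugate when an automorphism of the projective plane, that is, an element
of `PGL₃(ℂ)` (represented by an element of `GL₃(ℂ)`), transforms one into the other. -/
def Foliation.IsConjugate {d : ℕ} (F F' : Foliation d) : Prop :=
  ∃ g : GL (Fin 3) ℂ, F' = F.pullback g

/-! ### Homogeneous foliations -/

/-- The homothety `(x, y) ↦ l (x, y)` of the affine chart `z = 1`. -/
def homothety (l : ℂˣ) : GL (Fin 3) ℂ :=
  ⟨Matrix.diagonal ![(l : ℂ), l, 1], Matrix.diagonal ![((l⁻¹ : ℂˣ) : ℂ), ((l⁻¹ : ℂˣ) : ℂ), 1],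
    by
      rw [Matrix.diagonal_mul_diagonal, ← Matrix.diagonal_one]
      congr 1
      ext i
      fin_cases i <;> simp,
    by
      rw [Matrix.diagonal_mul_diagonal, ← Matrix.diagonal_one]
      congr 1
      ext i
      fin_cases i <;> simp⟩

/-- A foliation is homogeneous if in some affine chart it is invariant under all homotheties
`(x, y) ↦ l (x, y)`, `l ≠ 0`.  The affine chart is given by the automorphism `g`. -/
def Foliation.IsHomogeneous {d : ℕ} (F : Foliation d) : Prop :=
  ∃ g : GL (Fin 3) ℂ, ∀ l : ℂˣ, (F.pullback g).pullback (homothety l) = F.pullback g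

/-! ### Affine charts -/

/-- The polynomial `p(x, y, 1)`. -/
def dehomogenize : MvPolynomial (Fin 3) ℂ →ₐ[ℂ] MvPolynomial (Fin 2) ℂ :=
  aeval ![X 0, X 1, 1]

/-- The foliation is described in the affine chart `z = 1` by the `1`-form `A dx + B dy` (whose
coefficients `A = η 0` and `B = η 1` are meant to be without common factor): the restriction
`a(x, y, 1) dx + b(x, y, 1) dy` of a homogeneous form defining it is `A dx + B dy`. -/
def Foliation.IsDescribedBy {d : ℕ} (F : Foliation d) (η : Fin 2 → MvPolynomial (Fin 2) ℂ) : Prop :=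
  ∃ ω : FoliationForm d, Quotient.mk (formSetoid d) ω = F ∧
    dehomogenize (ω.coeff 0) = η 0 ∧ dehomogenize (ω.coeff 1) = η 1

/-! ### The inflection divisor and convexity -/

/-- The homogeneous vector field `Z = E ∂/∂x + F ∂/∂y + G ∂/∂z` of degree `d` describes the
foliation: `ω = i_R i_Z (dx ∧ dy ∧ dz)`, where `R` is the radial vector field. In coordinates
the right-hand side is the cross product of `(E, F, G)` and `(x, y, z)`. -/
def FoliationForm.IsDescribedByField {d : ℕ} (ω : FoliationForm d)
    (Z : Fin 3 → MvPolynomial (Fin 3) ℂ) : Prop :=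
  (∀ i, (Z i).IsHomogeneous d) ∧ ω.coeff = Z ⨯₃ (fun i => X i)

/-- The derivative `Z(p)` of `p` along the vector field `Z`. -/
def alongField (Z : Fin 3 → MvPolynomial (Fin 3) ℂ) (p : MvPolynomial (Fin 3) ℂ) :
    MvPolynomial (Fin 3) ℂ :=
  ∑ i, Z i * pderiv i p

/-- The determinant with columns `(x, y, z)`, `(E, F, G)`, `(Z(E), Z(F), Z(G))`: the equation of
the inflection divisor. -/
def inflectionPoly (Z : Fin 3 → MvPolynomial (Fin 3) ℂ) : MvPolynomial (Fin 3) ℂ :=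
  Matrix.det !![X 0, Z 0, alongField Z (Z 0);
                X 1, Z 1, alongField Z (Z 1);
                X 2, Z 2, alongField Z (Z 2)]

/-- `I` is an equation of the inflection divisor of `F`. A field `Z` describing a given form is
unique up to multiples of the radial field, which do not change the determinant, so `I` is unique
up to a nonzero constant factor. -/
def Foliation.IsInflectionEquation {d : ℕ} (F : Foliation d) (I : MvPolynomial (Fin 3) ℂ) : Prop :=
  ∃ (ω : FoliationForm d) (Z : Fin 3 → MvPolynomial (Fin 3) ℂ),
    Quotient.mk (formSetoid d) ω = F ∧ ω.IsDescribedByField Z ∧ I = inflectionPoly Z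

/-- The linear form `u 0 x + u 1 y + u 2 z`. -/
def linForm (u : Fin 3 → ℂ) : MvPolynomial (Fin 3) ℂ := ∑ i, C (u i) * X i

/-- The line `ℓ = 0`, with `ℓ` the linear form of coefficients `u`, is invariant by the foliation
defined by `ω`: all coefficients of `ω ∧ dℓ` are divisible by `ℓ`. -/
def Foliation.IsInvariantLine {d : ℕ} (F : Foliation d) (u : Fin 3 → ℂ) : Prop :=
  u ≠ 0 ∧ ∃ ω : FoliationForm d, Quotient.mk (formSetoid d) ω = F ∧
    ∀ i, linForm u ∣ (ω.coeff ⨯₃ (fun j => C (u j))) i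

/-- A foliation is convex if its inflection divisor is a product of invariant lines (counted with
multiplicities). -/
def Foliation.IsConvex {d : ℕ} (F : Foliation d) : Prop :=
  ∃ (c : ℂ) (s : Multiset (Fin 3 → ℂ)), c ≠ 0 ∧
    F.IsInflectionEquation (C c * (s.map linForm).prod) ∧ ∀ u ∈ s, F.IsInvariantLine u

/-! ### Radial singularities, transverse inflection lines and the type -/

/-- The `k`-jet of `p` at the origin. -/
def jet (k : ℕ) (p : MvPolynomial (Fin 2) ℂ) : MvPolynomial (Fin 2) ℂ :=
  ∑ i ∈ Finset.range (k + 1), homogeneousComponent i p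

/-- The vanishing order at the origin of the vector field `X = B ∂/∂x - A ∂/∂y`, the minimum of
the vanishing orders of `A` and `B`. -/
def vanishingOrder (A B : MvPolynomial (Fin 2) ℂ) : ℕ :=
  sInf {k | homogeneousComponent k A ≠ 0 ∨ homogeneousComponent k B ≠ 0}

/-- The tangency order at the origin of the foliation defined by `X = B ∂/∂x - A ∂/∂y` with a
generic line through the origin: the least `k ≥ ν` with `det (J^k X, R) ≠ 0`, where
`R = x ∂/∂x + y ∂/∂y`. -/
def tangencyOrder (A B : MvPolynomial (Fin 2) ℂ) : ℕ :=
  sInf {k | vanishingOrder A B ≤ k ∧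
    Matrix.det !![jet k B, X 0; -jet k A, (X 1 : MvPolynomial (Fin 2) ℂ)] ≠ 0}

/-- `s` is a radial singularity of order `k` of `F`: in an affine chart centred at `s` (given by a
`g` that maps the point `[0 : 0 : 1]` to `s`) one has `ν = 1` and `τ = k + 1`. -/
def Foliation.IsRadialOfOrder {d : ℕ} (F : Foliation d) (s : ℙ ℂ (Fin 3 → ℂ)) (k : ℕ) : Prop :=
  ∃ (g : GL (Fin 3) ℂ) (η : Fin 2 → MvPolynomial (Fin 2) ℂ),
    g.val *ᵥ ![0, 0, 1] ∈ s.submodule ∧ (F.pullback g).IsDescribedBy η ∧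
    vanishingOrder (η 0) (η 1) = 1 ∧ tangencyOrder (η 0) (η 1) = k + 1

/-- The line with coefficients `t` (a point of the dual plane) is a transverse inflection line of
order `k` of `F`: it is not invariant and has multiplicity `k` in the inflection divisor. -/
def Foliation.IsTransverseInflectionLine {d : ℕ} (F : Foliation d) (t : ℙ ℂ (Fin 3 → ℂ)) (k : ℕ) :
    Prop :=
  ∃ (u : Fin 3 → ℂ) (I : MvPolynomial (Fin 3) ℂ), u ≠ 0 ∧ u ∈ t.submodule ∧
    ¬ F.IsInvariantLine u ∧ F.IsInflectionEquation I ∧ linForm u ^ k ∣ I ∧ ¬ linForm u ^ (k + 1) ∣ I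

/-- The polynomial ring `ℤ[R₁, R₂, …, T₁, T₂, …]` in which types take their values. -/
abbrev TypeRing : Type := MvPolynomial (ℕ ⊕ ℕ) ℤ

/-- The variable `R_k`. -/
def TypeRing.R (k : ℕ) : TypeRing := X (Sum.inl k)

/-- The variable `T_k`. -/
def TypeRing.T (k : ℕ) : TypeRing := X (Sum.inr k)

/-- The type `∑ (r_k R_k + t_k T_k)`, `1 ≤ k ≤ d - 1`, of a homogeneous foliation of degree `d`:
`r_k` and `t_k` are the (finite) numbers of its radial singularities of order `k` and of its
transverse inflection lines of order `k`. -/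
def Foliation.homType {d : ℕ} (F : Foliation d) : TypeRing :=
  ∑ k ∈ Finset.Icc 1 (d - 1),
    (Set.ncard {s | F.IsRadialOfOrder s k} • TypeRing.R k
      + Set.ncard {t | F.IsTransverseInflectionLine t k} • TypeRing.T k)

/-! ### The five forms -/

/-- The affine coordinate `x`. -/
def x : MvPolynomial (Fin 2) ℂ := X 0

/-- The affine coordinate `y`. -/
def y : MvPolynomial (Fin 2) ℂ := X 1

/-- The five forms `ω_i = A dx + B dy`, written as pairs `![A, B]`. -/
def omega : Fin 5 → Fin 2 → MvPolynomial (Fin 2) ℂ :=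
  ![![y ^ 4, -x ^ 4],
    ![y ^ 3 * (2 * x - y), x ^ 3 * (x - 2 * y)],
    ![y ^ 2 * (6 * x ^ 2 + 4 * x * y + y ^ 2), -(x ^ 3 * (x + 4 * y))],
    ![y ^ 3 * (4 * x + y), x ^ 3 * (x + 4 * y)],
    ![y ^ 2 * (6 * x ^ 2 + 4 * x * y + y ^ 2), 3 * x ^ 4]]

/-- The types of the five foliations. -/
def omegaType : Fin 5 → TypeRing :=
  ![2 * TypeRing.R 3,
    3 * TypeRing.R 2,
    TypeRing.R 1 + TypeRing.R 2 + TypeRing.R 3,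
    2 * TypeRing.R 1 + 2 * TypeRing.R 2,
    3 * TypeRing.R 1 + TypeRing.R 3]

end PlaneFoliation

end

/-!
A homogeneous foliation of degree `4` is, after a change of coordinates, the cone of a `1`-form
`A dx + B dy` in the chart `z = 1`, with `A` and `B` coprime binary quartic forms
(`Foliation.IsHomogeneous.exists_isCone`). Everything is read off from the rational map
`f = [-B : A]` of degree `4` of the line at infinity to itself: the inflection divisor is
`z (x A + y B) Jac (A, B)` up to a constant, the zeros of the tangent cone `x A + y B` are the fixed
points of `f`, and those of the Jacobian determinant are its critical points. The invariant lines
through the origin of the chart are the lines of the tangent cone, so that the cone is convex if and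
only if all critical points of `f` are fixed (`Foliation.IsCone.cone_eq_zero`,
`Foliation.IsCone.isConvex`).

The classification (`Foliation.IsCone.isModel`) puts a critical point of the largest local degree at
`[1 : 0]`. Since it is fixed, the map is explicit enough:

* local degree `4`: `f` is conjugate to a quartic polynomial, whose critical points are the roots of
  a centred cubic. Three equal roots, two equal roots and three distinct roots lead to
  one model each;
* local degree `3`: the second preimage of `[1 : 0]` is moved to `[0 : 1]`. A separable critical
  equation is excluded by comparing degrees; a double critical point is scaled to `1`, and the
  remaining two critical points coincide or not, which gives the last two models (a triple critical
  point belongs to the previous case);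
* local degree `2` at all critical points: there would be six critical points among the five fixed
  points.

In the other direction, a radial singularity of order `k` of a cone is a point `v` at infinity where
`v₀ A + v₁ B` vanishes to order exactly `k + 1`: in a chart centred at `v` the Euler condition gives
`x η₀ + y η₁ = c z (v₀ A + v₁ B)` for the affine form `η` and a constant `c ≠ 0`
(`Foliation.IsCone.describedBy`, `Foliation.IsCone.ncard_isRadialOfOrder`). This gives the types of
the models. Transverse inflection lines do not occur on a convex foliation. The numbers of radial
singularities of orders `1` and `3` are invariant under conjugation
(`Foliation.IsConjugate.ncard_isRadialOfOrder`) and distinguish the five models.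
-/

noncomputable section

namespace PlaneFoliation

open MvPolynomial
open scoped Matrix LinearAlgebra.Projectivization

/-! ### The action of linear automorphisms -/

theorem subst_C (g : Matrix (Fin 3) (Fin 3) ℂ) (c : ℂ) : subst g (C c) = C c := by
  simp [subst]

theorem subst_X (g : Matrix (Fin 3) (Fin 3) ℂ) (i : Fin 3) :
    subst g (X i) = ∑ j, C (g i j) * X j := by
  simp [subst]

theorem mk_eq_mk_iff {d : ℕ} {ω η : FoliationForm d} :
    Quotient.mk (formSetoid d) ω = Quotient.mk (formSetoid d) η ↔
      ∃ k : ℂ, k ≠ 0 ∧ ∀ i, η.coeff i = C k * ω.coeff i :=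
  ⟨fun h => Quotient.exact h, fun h => Quotient.sound h⟩

theorem mk_eq_mk_of_coeff_eq {d : ℕ} {ω η : FoliationForm d} (h : ω.coeff = η.coeff) :
    Quotient.mk (formSetoid d) ω = Quotient.mk (formSetoid d) η :=
  mk_eq_mk_iff.2 ⟨1, one_ne_zero, fun i => by simp [h]⟩

theorem Foliation.pullback_pullback {d : ℕ} (g h : GL (Fin 3) ℂ) (F : Foliation d) :
    (F.pullback g).pullback h = F.pullback (g * h) := by
  induction F using Quotient.inductionOn with
  | h ω =>
    refine mk_eq_mk_of_coeff_eq (funext fun j => ?_)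
    simp only [FoliationForm.pullback, pullbackCoeff, map_sum, map_mul, subst_subst, subst_C,
      Units.val_mul, Finset.mul_sum]
    rw [Finset.sum_comm]
    refine Finset.sum_congr rfl fun i _ => ?_
    rw [Matrix.mul_apply, map_sum, Finset.sum_mul]
    refine Finset.sum_congr rfl fun k _ => ?_
    rw [C_mul]
    ring

theorem Foliation.pullback_one {d : ℕ} (F : Foliation d) : F.pullback 1 = F := by
  induction F using Quotient.inductionOn with
  | h ω =>
    refine mk_eq_mk_of_coeff_eq (funext fun j => ?_)
    simp [FoliationForm.pullback, pullbackCoeff, subst_one, Matrix.one_apply]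

theorem Foliation.IsConjugate.symm {d : ℕ} {F G : Foliation d} (h : F.IsConjugate G) :
    G.IsConjugate F := by
  obtain ⟨g, rfl⟩ := h
  exact ⟨g⁻¹, by rw [Foliation.pullback_pullback, mul_inv_cancel, Foliation.pullback_one]⟩

/-- The chain rule for a linear substitution. -/
theorem pderiv_subst (g : Matrix (Fin 3) (Fin 3) ℂ) (j : Fin 3) (p : MvPolynomial (Fin 3) ℂ) :
    pderiv j (subst g p) = ∑ i, C (g i j) * subst g (pderiv i p) := by
  induction p using MvPolynomial.induction_on with
  | C a => simp
  | add p q hp hq => simp only [map_add, hp, hq, mul_add, Finset.sum_add_distrib]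
  | mul_X p n hp =>
    have hX : pderiv j (subst g (X n)) = C (g n j) := by
      rw [subst_X, map_sum, Finset.sum_eq_single j]
      · rw [pderiv_C_mul, pderiv_X_self, mul_one]
      · intro i _ hi
        rw [pderiv_C_mul, pderiv_X_of_ne hi, mul_zero]
      · simp
    have h2 : ∀ i, subst g (pderiv i (p * X n))
        = subst g (pderiv i p) * subst g (X n) + subst g p * (if i = n then 1 else 0) := by
      intro i
      rw [pderiv_mul, map_add, map_mul, map_mul]
      by_cases hi : i = n
      · subst hi
        simp
      · rw [pderiv_X_of_ne (Ne.symm hi)]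
        simp [hi]
    have h3 : ∑ i, C (g i j) * (subst g p * (if i = n then 1 else 0)) = C (g n j) * subst g p := by
      rw [Finset.sum_eq_single n (fun i _ hi => by rw [if_neg hi, mul_zero, mul_zero])
        (fun h => absurd (Finset.mem_univ n) h), if_pos rfl, mul_one]
    have h4 : ∑ i, C (g i j) * (subst g (pderiv i p) * subst g (X n))
        = (∑ i, C (g i j) * subst g (pderiv i p)) * subst g (X n) := by
      rw [Finset.sum_mul]
      exact Finset.sum_congr rfl fun i _ => (mul_assoc _ _ _).symm
    have h5 : ∑ i, C (g i j) * subst g (pderiv i (p * X n))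
        = ∑ i, (C (g i j) * (subst g (pderiv i p) * subst g (X n))
          + C (g i j) * (subst g p * (if i = n then 1 else 0))) :=
      Finset.sum_congr rfl fun i _ => by rw [h2 i, mul_add]
    rw [h5, Finset.sum_add_distrib, h3, h4, map_mul, pderiv_mul, hp, hX, mul_comm (subst g p)]

/-! ### Inflection equations -/

theorem inflectionPoly_eq (Z : Fin 3 → MvPolynomial (Fin 3) ℂ) :
    inflectionPoly Z =
      X 0 * (Z 1 * alongField Z (Z 2) - alongField Z (Z 1) * Z 2)
      - Z 0 * (X 1 * alongField Z (Z 2) - alongField Z (Z 1) * X 2)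
      + alongField Z (Z 0) * (X 1 * Z 2 - Z 1 * X 2) := by
  rw [inflectionPoly, Matrix.det_fin_three]
  simp
  ring

/-- A vector field parallel to the radial field at every point is a multiple of the radial
field. -/
theorem exists_eq_mul_X_of_cross_eq_zero (W : Fin 3 → MvPolynomial (Fin 3) ℂ)
    (h : W ⨯₃ (fun i => X i) = 0) : ∃ p : MvPolynomial (Fin 3) ℂ, ∀ i, W i = p * X i := by
  have h0 := congrFun h 0
  have h1 := congrFun h 1
  simp [cross_apply] at h0 h1
  have hd : (X 2 : MvPolynomial (Fin 3) ℂ) ∣ W 2 := by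
    have hx : (X 2 : MvPolynomial (Fin 3) ℂ) ∣ W 2 * X 1 := ⟨W 1, by linear_combination -h0⟩
    rcases (X_prime (R := ℂ) (i := (2 : Fin 3))).dvd_or_dvd hx with h | h
    · exact h
    · simp [X_dvd_X] at h
  obtain ⟨p, hp⟩ := hd
  have hX : (X 2 : MvPolynomial (Fin 3) ℂ) ≠ 0 := X_ne_zero 2
  refine ⟨p, fun i => ?_⟩
  fin_cases i
  · apply mul_right_cancel₀ hX
    simp only [Fin.zero_eta]
    linear_combination -h1 + X 0 * hp
  · apply mul_right_cancel₀ hX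
    simp only [Fin.mk_one]
    linear_combination h0 + X 1 * hp
  · simp only [Fin.reduceFinMk]
    rw [hp, mul_comm]

/-- Adding a multiple of the radial field does not change the inflection determinant. -/
theorem inflectionPoly_add_radial {d : ℕ} {Z W : Fin 3 → MvPolynomial (Fin 3) ℂ} {k : ℂ}
    {p : MvPolynomial (Fin 3) ℂ} (hZ : ∀ i, (Z i).IsHomogeneous d)
    (hW : ∀ i, W i = C k * Z i + p * X i) : inflectionPoly W = C (k ^ 3) * inflectionPoly Z := by
  have hE : ∀ i, X 0 * pderiv 0 (Z i) + X 1 * pderiv 1 (Z i) + X 2 * pderiv 2 (Z i)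
      = C (d : ℂ) * Z i := by
    intro i
    have := (hZ i).sum_X_mul_pderiv
    rw [Fin.sum_univ_three, nsmul_eq_mul] at this
    rw [this, map_natCast]
  have hal : ∀ i, alongField W (W i) = C k ^ 2 * alongField Z (Z i)
      + (C k * p * (C (d : ℂ) + 1)) * Z i
      + (C k * alongField Z p + p * (X 0 * pderiv 0 p + X 1 * pderiv 1 p + X 2 * pderiv 2 p)
        + p ^ 2) * X i := by
    intro i
    have hp : ∀ j, pderiv j (W i) = C k * pderiv j (Z i) + pderiv j p * X i
        + p * (if j = i then 1 else 0) := by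
      intro j
      rw [hW i, map_add, pderiv_C_mul, pderiv_mul, pderiv_X]
      by_cases h : j = i
      · simp [h]; ring
      · simp [h]
    have hi : ∑ j, W j * (p * (if j = i then (1 : MvPolynomial (Fin 3) ℂ) else 0)) = W i * p := by
      simp
    simp only [alongField, hp, mul_add, Finset.sum_add_distrib, hi]
    simp only [Fin.sum_univ_three, hW]
    linear_combination (C k * p) * hE i
  rw [inflectionPoly_eq, inflectionPoly_eq, hal, hal, hal, hW, hW, hW, C_pow]
  ring

/-- The equation of the inflection divisor is unique up to a nonzero constant. -/
theorem Foliation.IsInflectionEquation.unique {d : ℕ} {F : Foliation d}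
    {I J : MvPolynomial (Fin 3) ℂ} (hI : F.IsInflectionEquation I)
    (hJ : F.IsInflectionEquation J) : ∃ k : ℂ, k ≠ 0 ∧ J = C k * I := by
  obtain ⟨ω, Z, hω, hZ, rfl⟩ := hI
  obtain ⟨η, W, hη, hW, rfl⟩ := hJ
  obtain ⟨k, hk, h⟩ := mk_eq_mk_iff.1 (hω.trans hη.symm)
  obtain ⟨p, hp⟩ := exists_eq_mul_X_of_cross_eq_zero (fun i => W i - C k * Z i) (by
    have h0 := h 0
    have h1 := h 1
    have h2 := h 2
    rw [hZ.2, hW.2] at h0 h1 h2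
    simp [cross_apply] at h0 h1 h2
    ext1 i
    fin_cases i <;> simp [cross_apply]
    · linear_combination h0
    · linear_combination h1
    · linear_combination h2)
  refine ⟨k ^ 3, pow_ne_zero _ hk, inflectionPoly_add_radial (p := p) hZ.1 fun i => ?_⟩
  linear_combination hp i

/-- The vector field `g⁻¹ ∘ Z ∘ g`. -/
def pullbackField (g : GL (Fin 3) ℂ) (Z : Fin 3 → MvPolynomial (Fin 3) ℂ) (i : Fin 3) :
    MvPolynomial (Fin 3) ℂ :=
  ∑ k, C (g⁻¹.val i k) * subst g.val (Z k)

theorem sum_mul_pullbackField (g : GL (Fin 3) ℂ) (Z : Fin 3 → MvPolynomial (Fin 3) ℂ)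
    (i : Fin 3) : ∑ j, C (g.val i j) * pullbackField g Z j = subst g.val (Z i) := by
  have hgg : g.val * g⁻¹.val = 1 := g.mul_inv
  simp only [pullbackField, Finset.mul_sum]
  rw [Finset.sum_comm]
  have h1 : ∀ k, ∑ j, C (g.val i j) * (C (g⁻¹.val j k) * subst g.val (Z k))
      = C ((g.val * g⁻¹.val) i k) * subst g.val (Z k) := by
    intro k
    rw [Matrix.mul_apply, map_sum, Finset.sum_mul]
    refine Finset.sum_congr rfl fun j _ => ?_
    rw [C_mul, mul_assoc]
  rw [Finset.sum_congr rfl fun k _ => h1 k, hgg]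
  simp [Matrix.one_apply]

theorem sum_mul_alongField_pullbackField (g : GL (Fin 3) ℂ)
    (Z : Fin 3 → MvPolynomial (Fin 3) ℂ) (i : Fin 3) :
    ∑ j, C (g.val i j) * alongField (pullbackField g Z) (pullbackField g Z j)
      = subst g.val (alongField Z (Z i)) := by
  have h1 : ∑ j, C (g.val i j) * alongField (pullbackField g Z) (pullbackField g Z j)
      = alongField (pullbackField g Z) (subst g.val (Z i)) := by
    rw [← sum_mul_pullbackField g Z i]
    simp only [alongField, map_sum, pderiv_C_mul, Finset.mul_sum]
    rw [Finset.sum_comm]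
    exact Finset.sum_congr rfl fun _ _ => Finset.sum_congr rfl fun _ _ => by ring
  rw [h1]
  simp only [alongField, pderiv_subst, map_sum, map_mul, Finset.mul_sum]
  rw [Finset.sum_comm]
  refine Finset.sum_congr rfl fun k _ => ?_
  rw [← sum_mul_pullbackField g Z k, Finset.sum_mul]
  exact Finset.sum_congr rfl fun _ _ => by ring

theorem det_mul_inflectionPoly_pullbackField (g : GL (Fin 3) ℂ)
    (Z : Fin 3 → MvPolynomial (Fin 3) ℂ) :
    C g.val.det * inflectionPoly (pullbackField g Z) = subst g.val (inflectionPoly Z) := by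
  simp only [inflectionPoly_eq, map_add, map_sub, map_mul, ← sum_mul_alongField_pullbackField,
    subst_X]
  simp only [← sum_mul_pullbackField g Z, Fin.sum_univ_three, Matrix.det_fin_three, map_add,
    map_sub, map_mul]
  ring

theorem GL_det_ne_zero (g : GL (Fin 3) ℂ) : g.val.det ≠ 0 :=
  ((Matrix.isUnit_iff_isUnit_det _).1 g.isUnit).ne_zero

theorem Foliation.IsInflectionEquation.pullback {d : ℕ} {F : Foliation d}
    {I : MvPolynomial (Fin 3) ℂ} (hI : F.IsInflectionEquation I) (g : GL (Fin 3) ℂ) :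
    ∃ k : ℂ, k ≠ 0 ∧ (F.pullback g).IsInflectionEquation (C k * subst g.val I) := by
  obtain ⟨ω, Z, rfl, hZ, rfl⟩ := hI
  set δ := g.val.det with hδ
  have hδ0 : δ ≠ 0 := GL_det_ne_zero g
  refine ⟨δ ^ 2, pow_ne_zero _ hδ0, ω.pullback g, fun i => C δ * pullbackField g Z i,
    rfl, ⟨fun i => ?_, ?_⟩, ?_⟩
  · refine IsHomogeneous.C_mul (IsHomogeneous.sum _ _ _ fun k _ => IsHomogeneous.C_mul ?_ _) _
    have := (hZ.1 k).aeval (fun i => ∑ j, C (g.val i j) * (X j : MvPolynomial (Fin 3) ℂ))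
      (n := 1) (fun i => IsHomogeneous.sum _ _ _ fun j _ => (isHomogeneous_X _ _).C_mul _)
    simpa [subst] using this
  · ext1 i
    simp only [FoliationForm.pullback, pullbackCoeff, hZ.2, Fin.sum_univ_three, cross_apply]
    simp only [Matrix.cons_val, map_sub, map_mul, ← sum_mul_pullbackField g Z,
      subst_X, Fin.sum_univ_three, hδ, Matrix.det_fin_three, map_add]
    fin_cases i <;> simp <;> ring
  · have hp : ∀ i, (fun i => C δ * pullbackField g Z i) i
        = C δ * pullbackField g Z i + 0 * X i := by simp
    have hh : ∀ i, (pullbackField g Z i).IsHomogeneous d := by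
      intro i
      refine IsHomogeneous.sum _ _ _ fun k _ => IsHomogeneous.C_mul ?_ _
      have := (hZ.1 k).aeval (fun i => ∑ j, C (g.val i j) * (X j : MvPolynomial (Fin 3) ℂ))
        (n := 1) (fun i => IsHomogeneous.sum _ _ _ fun j _ => (isHomogeneous_X _ _).C_mul _)
      simpa [subst] using this
    rw [inflectionPoly_add_radial hh hp, ← det_mul_inflectionPoly_pullbackField, ← hδ,
      ← mul_assoc, ← C_mul]
    ring_nf

/-! ### Invariant lines and convexity -/

theorem subst_linForm (g : Matrix (Fin 3) (Fin 3) ℂ) (u : Fin 3 → ℂ) :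
    subst g (linForm u) = linForm (u ᵥ* g) := by
  simp only [linForm, map_mul, subst_C, subst_X, Matrix.vecMul, dotProduct,
    Fin.sum_univ_three, map_add]
  ring

theorem Foliation.IsInvariantLine.pullback {d : ℕ} {F : Foliation d} {u : Fin 3 → ℂ}
    (h : F.IsInvariantLine u) (g : GL (Fin 3) ℂ) :
    (F.pullback g).IsInvariantLine (u ᵥ* g.val) := by
  obtain ⟨hu, ω, rfl, h⟩ := h
  refine ⟨fun h0 => hu ?_, ω.pullback g, rfl, fun i => ?_⟩
  · have hgg : g.val * g⁻¹.val = 1 := g.mul_inv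
    have := congrArg (· ᵥ* g⁻¹.val) h0
    simpa [Matrix.vecMul_vecMul, hgg] using this
  · have hd : ∀ i, linForm (u ᵥ* g.val) ∣ subst g.val ((ω.coeff ⨯₃ (fun j => C (u j))) i) := by
      intro i
      rw [← subst_linForm]
      exact map_dvd _ (h i)
    have h0 := hd 0
    have h1 := hd 1
    have h2 := hd 2
    simp only [cross_apply, Matrix.cons_val, map_sub, map_mul, subst_C] at h0 h1 h2
    have key : ∀ a b c : MvPolynomial (Fin 3) ℂ, linForm (u ᵥ* g.val) ∣
        a * (subst g.val (ω.coeff 1) * C (u 2) - subst g.val (ω.coeff 2) * C (u 1))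
        + b * (subst g.val (ω.coeff 2) * C (u 0) - subst g.val (ω.coeff 0) * C (u 2))
        + c * (subst g.val (ω.coeff 0) * C (u 1) - subst g.val (ω.coeff 1) * C (u 0)) :=
      fun a b c => dvd_add (dvd_add (h0.mul_left _) (h1.mul_left _)) (h2.mul_left _)
    have key' : ∀ i j : Fin 3, linForm (u ᵥ* g.val) ∣
        pullbackCoeff g.val ω.coeff i * C ((u ᵥ* g.val) j)
          - pullbackCoeff g.val ω.coeff j * C ((u ᵥ* g.val) i) := by
      intro i j
      convert key (C (g.val 1 i * g.val 2 j - g.val 2 i * g.val 1 j))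
        (C (g.val 2 i * g.val 0 j - g.val 0 i * g.val 2 j))
        (C (g.val 0 i * g.val 1 j - g.val 1 i * g.val 0 j)) using 1
      simp only [pullbackCoeff, Matrix.vecMul, dotProduct, Fin.sum_univ_three, map_add, map_mul,
        map_sub]
      ring
    simp only [cross_apply, FoliationForm.pullback]
    fin_cases i
    · exact key' 1 2
    · exact key' 2 0
    · exact key' 0 1

theorem Foliation.IsConvex.pullback {d : ℕ} {F : Foliation d} (h : F.IsConvex)
    (g : GL (Fin 3) ℂ) : (F.pullback g).IsConvex := by
  obtain ⟨c, s, hc, hI, hs⟩ := h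
  obtain ⟨k, hk, hJ⟩ := hI.pullback g
  refine ⟨k * c, s.map (fun u => u ᵥ* g.val), mul_ne_zero hk hc, ?_, ?_⟩
  · convert hJ using 1
    rw [map_mul (subst g.val), subst_C, map_multiset_prod, Multiset.map_map, Multiset.map_map,
      C_mul, mul_assoc]
    congr 4
    ext1 u
    exact (subst_linForm g.val u).symm
  · intro u hu
    obtain ⟨w, hw, rfl⟩ := Multiset.mem_map.1 hu
    exact (hs w hw).pullback g

theorem linForm_eq_sum (u : Fin 3 → ℂ) :
    linForm u = C (u 0) * X 0 + C (u 1) * X 1 + C (u 2) * X 2 := by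
  simp [linForm, Fin.sum_univ_three]

theorem coeff_linForm (u : Fin 3 → ℂ) (i : Fin 3) :
    (linForm u).coeff (Finsupp.single i 1) = u i := by
  simp only [linForm, coeff_sum, coeff_C_mul, coeff_X]
  rw [Finset.sum_eq_single i]
  · simp
  · intro j _ hj
    rw [if_neg, mul_zero]
    exact fun h => hj (Finsupp.single_left_injective one_ne_zero h)
  · simp

theorem linForm_ne_zero {u : Fin 3 → ℂ} (hu : u ≠ 0) : linForm u ≠ 0 := by
  intro h
  apply hu
  ext i
  rw [← coeff_linForm u i, h]
  simp

theorem isHomogeneous_linForm (u : Fin 3 → ℂ) : (linForm u).IsHomogeneous 1 :=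
  IsHomogeneous.sum _ _ _ fun _ _ => (isHomogeneous_X _ _).C_mul _

theorem prime_linForm {u : Fin 3 → ℂ} (hu : u ≠ 0) : Prime (linForm u) := by
  rw [← irreducible_iff_prime]
  refine irreducible_of_totalDegree_eq_one
    ((isHomogeneous_linForm u).totalDegree (linForm_ne_zero hu)) fun x hx => ?_
  obtain ⟨i, hi⟩ := Function.ne_iff.1 hu
  have := hx (Finsupp.single i 1)
  rw [coeff_linForm] at this
  exact (ne_zero_of_dvd_ne_zero hi this).isUnit

/-- Two lines of which one is contained in the other coincide. -/
theorem exists_eq_smul_of_linForm_dvd {u w : Fin 3 → ℂ} (hw : w ≠ 0)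
    (h : linForm u ∣ linForm w) : ∃ k : ℂ, k ≠ 0 ∧ w = k • u := by
  obtain ⟨p, hp⟩ := h
  have h0 : linForm u ≠ 0 := by
    intro h
    rw [h, zero_mul] at hp
    exact linForm_ne_zero hw hp
  have hp0 : p ≠ 0 := by
    intro h
    rw [h, mul_zero] at hp
    exact linForm_ne_zero hw hp
  have hdeg := congrArg totalDegree hp
  rw [totalDegree_mul_of_isDomain h0 hp0, (isHomogeneous_linForm w).totalDegree
    (linForm_ne_zero hw), (isHomogeneous_linForm u).totalDegree h0] at hdeg
  obtain ⟨k, rfl⟩ : ∃ k, p = C k :=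
    ⟨_, totalDegree_eq_zero_iff_eq_C.1 (by omega)⟩
  refine ⟨k, fun h => hp0 (by simp [h]), ?_⟩
  ext i
  rw [← coeff_linForm w i, hp, mul_comm, coeff_C_mul, coeff_linForm]
  rfl

theorem Foliation.IsInvariantLine.of_smul {d : ℕ} {F : Foliation d} {u : Fin 3 → ℂ} {k : ℂ}
    (hk : k ≠ 0) (h : F.IsInvariantLine (k • u)) : F.IsInvariantLine u := by
  obtain ⟨hu, ω, hω, h⟩ := h
  refine ⟨fun h0 => hu (by simp [h0]), ω, hω, fun i => ?_⟩
  have hC : (C k⁻¹ * C k : MvPolynomial (Fin 3) ℂ) = 1 := by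
    rw [← C_mul, inv_mul_cancel₀ hk, C_1]
  have h1 : linForm u ∣ linForm (k • u) := by
    refine ⟨C k, ?_⟩
    simp only [linForm_eq_sum, Pi.smul_apply, smul_eq_mul, C_mul]
    ring
  have h2 := (h1.trans (h i)).mul_left (C k⁻¹)
  convert h2 using 1
  fin_cases i <;> simp [cross_apply]
  · linear_combination (ω.coeff 2 * C (u 1) - ω.coeff 1 * C (u 2)) * hC
  · linear_combination (ω.coeff 0 * C (u 2) - ω.coeff 2 * C (u 0)) * hC
  · linear_combination (ω.coeff 1 * C (u 0) - ω.coeff 0 * C (u 1)) * hC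

/-- All linear factors of the inflection divisor of a convex foliation are invariant. -/
theorem Foliation.IsConvex.isInvariantLine {d : ℕ} {F : Foliation d} (h : F.IsConvex)
    {I : MvPolynomial (Fin 3) ℂ} (hI : F.IsInflectionEquation I) {u : Fin 3 → ℂ} (hu : u ≠ 0)
    (hd : linForm u ∣ I) : F.IsInvariantLine u := by
  obtain ⟨c, s, hc, hJ, hs⟩ := h
  obtain ⟨k, hk, hk'⟩ := hI.unique hJ
  have hp := prime_linForm hu
  have h1 : linForm u ∣ (s.map linForm).prod := by
    have h2 := (hd.mul_left (C k)).mul_left (C c⁻¹)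
    rw [← hk', ← mul_assoc, ← C_mul, inv_mul_cancel₀ hc, C_1, one_mul] at h2
    exact h2
  obtain ⟨w, hw, hdvd⟩ := hp.exists_mem_multiset_map_dvd h1
  obtain ⟨l, hl, rfl⟩ := exists_eq_smul_of_linForm_dvd (hs w hw).1 hdvd
  exact (hs _ hw).of_smul hl

theorem Foliation.IsConvex.not_isTransverseInflectionLine {d : ℕ} {F : Foliation d}
    (h : F.IsConvex) (t : ℙ ℂ (Fin 3 → ℂ)) {k : ℕ} (hk : k ≠ 0) :
    ¬ F.IsTransverseInflectionLine t k := by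
  rintro ⟨u, I, hu, -, hinv, hI, hd, -⟩
  exact hinv (h.isInvariantLine hI hu ((dvd_pow_self _ hk).trans hd))

/-! ### Invariance of the number of radial singularities -/

theorem mulVecLin_injective (g : GL (Fin 3) ℂ) : Function.Injective (Matrix.mulVecLin g.val) :=
  Matrix.mulVec_injective_iff_isUnit.2 g.isUnit

/-- The automorphism of the projective plane induced by `g`. -/
def projMap (g : GL (Fin 3) ℂ) : ℙ ℂ (Fin 3 → ℂ) → ℙ ℂ (Fin 3 → ℂ) :=
  Projectivization.map (Matrix.mulVecLin g.val) (mulVecLin_injective g)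

theorem projMap_injective (g : GL (Fin 3) ℂ) : Function.Injective (projMap g) :=
  Projectivization.map_injective _ _

theorem projMap_projMap_inv (g : GL (Fin 3) ℂ) (s : ℙ ℂ (Fin 3 → ℂ)) :
    projMap g (projMap g⁻¹ s) = s := by
  have hgg : g.val * g⁻¹.val = 1 := g.mul_inv
  induction s using Projectivization.ind with
  | h v hv =>
    simp only [projMap, Projectivization.map_mk]
    congr 1
    rw [Matrix.mulVecLin_apply, Matrix.mulVecLin_apply, Matrix.mulVec_mulVec, hgg,
      Matrix.one_mulVec]

theorem mulVec_mem_submodule_projMap (g : GL (Fin 3) ℂ) {s : ℙ ℂ (Fin 3 → ℂ)} {v : Fin 3 → ℂ}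
    (hv : v ∈ s.submodule) : g.val *ᵥ v ∈ (projMap g s).submodule := by
  induction s using Projectivization.ind with
  | h w hw =>
    simp only [projMap, Projectivization.map_mk, Projectivization.submodule_mk] at hv ⊢
    obtain ⟨c, rfl⟩ := Submodule.mem_span_singleton.1 hv
    exact Submodule.mem_span_singleton.2 ⟨c, by simp [Matrix.mulVec_smul]⟩

theorem Foliation.IsRadialOfOrder.projMap {d : ℕ} {F : Foliation d} {g : GL (Fin 3) ℂ}
    {s : ℙ ℂ (Fin 3 → ℂ)} {k : ℕ} (h : (F.pullback g).IsRadialOfOrder s k) :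
    F.IsRadialOfOrder (projMap g s) k := by
  obtain ⟨g', η, hs, hη, hν, hτ⟩ := h
  refine ⟨g * g', η, ?_, by rwa [Foliation.pullback_pullback] at hη, hν, hτ⟩
  have := mulVec_mem_submodule_projMap g hs
  rwa [Matrix.mulVec_mulVec] at this

theorem Foliation.IsConjugate.ncard_isRadialOfOrder {d : ℕ} {F G : Foliation d}
    (h : F.IsConjugate G) (k : ℕ) :
    Set.ncard {s | G.IsRadialOfOrder s k} = Set.ncard {s | F.IsRadialOfOrder s k} := by
  obtain ⟨g, rfl⟩ := h
  rw [← Set.ncard_image_of_injective _ (projMap_injective g)]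
  congr 1
  ext s
  constructor
  · rintro ⟨t, ht, rfl⟩
    exact ht.projMap
  · intro hs
    refine ⟨projMap g⁻¹ s, ?_, projMap_projMap_inv g s⟩
    have : F = (F.pullback g).pullback g⁻¹ := by
      rw [Foliation.pullback_pullback, mul_inv_cancel, Foliation.pullback_one]
    rw [Set.mem_ofPred_eq, this] at hs
    exact hs.projMap

/-! ### Cones over binary quartics -/

/-- The binary quartic form `∑ j, a j x ^ (4 - j) y ^ j`, as a polynomial in `x`, `y`, `z`. -/
def quartic (a : Fin 5 → ℂ) : MvPolynomial (Fin 3) ℂ :=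
  C (a 0) * X 0 ^ 4 + C (a 1) * X 0 ^ 3 * X 1 + C (a 2) * X 0 ^ 2 * X 1 ^ 2
    + C (a 3) * X 0 * X 1 ^ 3 + C (a 4) * X 1 ^ 4

/-- The value of a binary quartic form. -/
def qval (a : Fin 5 → ℂ) (p q : ℂ) : ℂ :=
  a 0 * p ^ 4 + a 1 * p ^ 3 * q + a 2 * p ^ 2 * q ^ 2 + a 3 * p * q ^ 3 + a 4 * q ^ 4

/-- The derivative of a binary quartic form in the first variable. -/
def qdx (a : Fin 5 → ℂ) (p q : ℂ) : ℂ :=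
  4 * a 0 * p ^ 3 + 3 * a 1 * p ^ 2 * q + 2 * a 2 * p * q ^ 2 + a 3 * q ^ 3

/-- The derivative of a binary quartic form in the second variable. -/
def qdy (a : Fin 5 → ℂ) (p q : ℂ) : ℂ :=
  a 1 * p ^ 3 + 2 * a 2 * p ^ 2 * q + 3 * a 3 * p * q ^ 2 + 4 * a 4 * q ^ 3

/-- The tangent cone `x A + y B` of the form `A dx + B dy`. Its zeros are the fixed points of the
rational map `[x : y] ↦ [-B : A]`. -/
def cone (a b : Fin 5 → ℂ) (p q : ℂ) : ℂ := p * qval a p q + q * qval b p q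

/-- The Jacobian determinant of `(A, B)`. Its zeros are the critical points of the rational map
`[x : y] ↦ [-B : A]`. -/
def jac (a b : Fin 5 → ℂ) (p q : ℂ) : ℂ := qdx a p q * qdy b p q - qdy a p q * qdx b p q

/-- The foliation given in the chart `z = 1` by `A dx + B dy`, with `A` and `B` the binary quartic
forms of coefficients `a` and `b`. -/
def Foliation.IsCone (F : Foliation 4) (a b : Fin 5 → ℂ) : Prop :=
  ∃ ω : FoliationForm 4, Quotient.mk (formSetoid 4) ω = F ∧
    ω.coeff = ![X 2 * quartic a, X 2 * quartic b, -(X 0 * quartic a + X 1 * quartic b)]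

theorem eval_quartic (a : Fin 5 → ℂ) (v : Fin 3 → ℂ) :
    eval v (quartic a) = qval a (v 0) (v 1) := by
  simp [quartic, qval]

theorem eval_pderiv_zero_quartic (a : Fin 5 → ℂ) (v : Fin 3 → ℂ) :
    eval v (pderiv 0 (quartic a)) = qdx a (v 0) (v 1) := by
  simp [quartic, qdx, pderiv_X]
  ring

theorem eval_pderiv_one_quartic (a : Fin 5 → ℂ) (v : Fin 3 → ℂ) :
    eval v (pderiv 1 (quartic a)) = qdy a (v 0) (v 1) := by
  simp [quartic, qdy, pderiv_X]
  ring

theorem pderiv_two_quartic (a : Fin 5 → ℂ) : pderiv 2 (quartic a) = 0 := by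
  simp [quartic, pderiv_X]

theorem isHomogeneous_quartic (a : Fin 5 → ℂ) : (quartic a).IsHomogeneous 4 := by
  have h : ∀ (c : ℂ) (i j : ℕ), i + j = 4 →
      (C c * X 0 ^ i * X 1 ^ j : MvPolynomial (Fin 3) ℂ).IsHomogeneous 4 := by
    intro c i j hij
    have := ((isHomogeneous_X_pow (R := ℂ) (0 : Fin 3) i).C_mul c).mul
      (isHomogeneous_X_pow (R := ℂ) (1 : Fin 3) j)
    rwa [hij] at this
  have : quartic a = C (a 0) * X 0 ^ 4 * X 1 ^ 0 + C (a 1) * X 0 ^ 3 * X 1 ^ 1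
      + C (a 2) * X 0 ^ 2 * X 1 ^ 2 + C (a 3) * X 0 ^ 1 * X 1 ^ 3
      + C (a 4) * X 0 ^ 0 * X 1 ^ 4 := by
    rw [quartic]
    ring
  rw [this]
  exact ((((h _ _ _ rfl).add (h _ _ _ rfl)).add (h _ _ _ rfl)).add (h _ _ _ rfl)).add
    (h _ _ _ rfl)

theorem Foliation.IsCone.unique {F G : Foliation 4} {a b : Fin 5 → ℂ} (hF : F.IsCone a b)
    (hG : G.IsCone a b) : F = G := by
  obtain ⟨ω, rfl, hω⟩ := hF
  obtain ⟨η, rfl, hη⟩ := hG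
  exact mk_eq_mk_of_coeff_eq (hω.trans hη.symm)

/-- The form `k ω`, for a nonzero constant `k`. -/
def FoliationForm.scale {d : ℕ} (k : ℂ) (hk : k ≠ 0) (ω : FoliationForm d) : FoliationForm d where
  coeff i := C k * ω.coeff i
  homogeneous i := (ω.homogeneous i).C_mul k
  euler := by
    have := congrArg (C k * ·) ω.euler
    simp only [Finset.mul_sum, mul_zero] at this
    rw [← this]
    exact Finset.sum_congr rfl fun i _ => by ring
  coprime p hp := by
    refine ω.coprime p fun i => ?_
    have := (hp i).mul_left (C k⁻¹)
    rwa [← mul_assoc, ← C_mul, inv_mul_cancel₀ hk, C_1, one_mul] at this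

theorem eval_subst (g : Matrix (Fin 3) (Fin 3) ℂ) (v : Fin 3 → ℂ) (P : MvPolynomial (Fin 3) ℂ) :
    eval v (subst g P) = eval (g *ᵥ v) P := by
  have : (aeval v).comp (subst g) = aeval (g *ᵥ v) := by
    apply MvPolynomial.algHom_ext
    intro i
    simp [subst_X, Matrix.mulVec, dotProduct]
  exact DFunLike.congr_fun this P

/-- A linear change of the coordinates `x`, `y` acts on the coefficients of a cone. -/
theorem Foliation.IsCone.exists_pullback {F : Foliation 4} {a b a' b' : Fin 5 → ℂ}
    (hF : F.IsCone a b) {k p q r s : ℂ} (hk : k ≠ 0)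
    (hdet : p * s - q * r ≠ 0)
    (ha : ∀ x y, qval a' x y = k * (p * qval a (p * x + q * y) (r * x + s * y)
      + r * qval b (p * x + q * y) (r * x + s * y)))
    (hb : ∀ x y, qval b' x y = k * (q * qval a (p * x + q * y) (r * x + s * y)
      + s * qval b (p * x + q * y) (r * x + s * y))) :
    ∃ g : GL (Fin 3) ℂ, (F.pullback g).IsCone a' b' := by
  obtain ⟨ω, rfl, hω⟩ := hF
  have hM : (!![p, q, 0; r, s, 0; 0, 0, 1] : Matrix (Fin 3) (Fin 3) ℂ).det ≠ 0 := by
    rw [Matrix.det_fin_three]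
    simpa using hdet
  obtain ⟨g, hg⟩ : ∃ g : GL (Fin 3) ℂ, g.val = !![p, q, 0; r, s, 0; 0, 0, 1] :=
    ⟨Matrix.GeneralLinearGroup.mkOfDetNeZero _ hM, rfl⟩
  refine ⟨g, (ω.pullback g).scale k hk, (mk_eq_mk_iff.2 ⟨k, hk, fun i => rfl⟩).symm, ?_⟩
  ext1 i
  apply MvPolynomial.funext
  intro v
  have hv : g.val *ᵥ v = ![p * v 0 + q * v 1, r * v 0 + s * v 1, v 2] := by
    rw [hg]
    ext i
    fin_cases i <;> simp [Matrix.mulVec, dotProduct, Fin.sum_univ_three]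
  simp only [FoliationForm.scale, FoliationForm.pullback, pullbackCoeff, eval_add, eval_mul,
    eval_subst, hv, hω, Fin.sum_univ_three, eval_C]
  rw [hg]
  fin_cases i
  · simp [eval_quartic, ha]
    ring
  · simp [eval_quartic, hb]
    ring
  · simp [eval_quartic, ha, hb]
    ring

/-! ### Homogeneous foliations are cones -/

theorem coeff_subst_diagonal (d : Fin 3 → ℂ) (p : MvPolynomial (Fin 3) ℂ) (m : Fin 3 →₀ ℕ) :
    (subst (Matrix.diagonal d) p).coeff m = (∏ i, d i ^ m i) * p.coeff m := by
  have hX : ∀ i, ∑ j, C (Matrix.diagonal d i j) * X j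
      = (C (d i) * X i : MvPolynomial (Fin 3) ℂ) := by
    intro i
    rw [Finset.sum_eq_single i (fun j _ hj => by rw [Matrix.diagonal_apply_ne' _ hj]; simp)
      (by simp), Matrix.diagonal_apply_eq]
  induction p using MvPolynomial.induction_on' with
  | monomial n c =>
    have : subst (Matrix.diagonal d) (monomial n c) = monomial n ((∏ i, d i ^ n i) * c) := by
      rw [subst, aeval_monomial, Finsupp.prod_fintype _ _ (by simp), monomial_eq,
        Finsupp.prod_fintype _ _ (by simp), algebraMap_eq]
      simp only [hX, mul_pow, Finset.prod_mul_distrib, map_mul, map_prod, map_pow]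
      ring
    rw [this, coeff_monomial, coeff_monomial]
    split_ifs with h
    · rw [h]
    · simp
  | add p q hp hq => rw [map_add, coeff_add, coeff_add, hp, hq, mul_add]

theorem X_two_dvd {p : MvPolynomial (Fin 3) ℂ} (h : ∀ m, p.coeff m ≠ 0 → m 2 ≠ 0) : X 2 ∣ p := by
  rw [p.as_sum]
  exact Finset.dvd_sum fun m hm => X_dvd_monomial.2 (Or.inr (h m (mem_support_iff.1 hm)))

theorem exists_eq_X_two_mul_quartic {p : MvPolynomial (Fin 3) ℂ}
    (h : ∀ m, p.coeff m ≠ 0 → m 0 + m 1 = 4 ∧ m 2 = 1) : ∃ a, p = X 2 * quartic a := by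
  set T : Fin 5 → (Fin 3 →₀ ℕ) := fun j =>
    Finsupp.single 0 (4 - j.val) + Finsupp.single 1 j.val + Finsupp.single 2 1 with hT
  have hT0 : ∀ j, T j 0 = 4 - j.val := by intro j; simp [hT]
  have hT1 : ∀ j, T j 1 = j.val := by intro j; simp [hT]
  have hT2 : ∀ j, T j 2 = 1 := by intro j; simp [hT]
  refine ⟨fun j => p.coeff (T j), ?_⟩
  have h1 : p = ∑ j, monomial (T j) (p.coeff (T j)) := by
    ext m
    rw [coeff_sum]
    simp only [coeff_monomial]
    by_cases hm : p.coeff m = 0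
    · rw [hm]
      refine (Finset.sum_eq_zero fun j _ => ?_).symm
      split_ifs with hj
      · rw [hj, hm]
      · rfl
    · obtain ⟨h4, h2⟩ := h m hm
      have hj : T ⟨m 1, by omega⟩ = m := by
        ext i
        fin_cases i
        · simp only [Fin.zero_eta, hT0]
          omega
        · simp only [Fin.mk_one, hT1]
        · simp only [Fin.reduceFinMk, hT2]
          omega
      rw [Finset.sum_eq_single ⟨m 1, by omega⟩]
      · rw [if_pos hj, hj]
      · intro j _ hj'
        rw [if_neg]
        intro h
        apply hj'
        ext
        simp only [← hT1 j, h]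
      · simp
  conv_lhs => rw [h1]
  have hmon : ∀ j c, (monomial (T j) c : MvPolynomial (Fin 3) ℂ)
      = C c * (X 0 ^ (4 - j.val) * X 1 ^ j.val * X 2) := by
    intro j c
    rw [monomial_eq, Finsupp.prod_fintype _ _ (by simp), Fin.prod_univ_three, hT0, hT1, hT2,
      pow_one]
  simp only [hmon, quartic, Fin.sum_univ_five]
  simp
  ring

/-- In the chart given by the definition, the invariance under the single homothety of ratio `2`
already forces every monomial of the form to have the same weight in `x`, `y`, `dx`, `dy`. -/
theorem FoliationForm.exists_weight {ω : FoliationForm 4}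
    (h : Foliation.pullback (homothety (Units.mk0 2 two_ne_zero)) (Quotient.mk (formSetoid 4) ω)
      = Quotient.mk (formSetoid 4) ω) :
    ∃ w : ℕ, ∀ i m, (ω.coeff i).coeff m ≠ 0 → m 0 + m 1 + ![1, 1, 0] i = w := by
  obtain ⟨k, hk, h⟩ := mk_eq_mk_iff.1 h
  have key : ∀ i m, (ω.coeff i).coeff m ≠ 0 → k * 2 ^ (m 0 + m 1 + ![1, 1, 0] i) = 1 := by
    intro i m hm
    have h1 : (ω.pullback (homothety (Units.mk0 2 two_ne_zero))).coeff i
        = C (![2, 2, 1] i) * subst (Matrix.diagonal ![2, 2, 1]) (ω.coeff i) := by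
      have hd : (homothety (Units.mk0 2 two_ne_zero)).val = Matrix.diagonal ![2, 2, 1] := rfl
      simp only [FoliationForm.pullback, pullbackCoeff, hd]
      rw [Finset.sum_eq_single i (fun j _ hj => by rw [Matrix.diagonal_apply_ne _ hj]; simp)
        (by simp), Matrix.diagonal_apply_eq]
    have h2 := congrArg (MvPolynomial.coeff m) (h i)
    rw [h1, coeff_C_mul, coeff_C_mul, coeff_subst_diagonal, Fin.prod_univ_three] at h2
    apply mul_right_cancel₀ hm
    rw [one_mul]
    conv_rhs => rw [h2]
    fin_cases i <;> simp <;> ring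
  by_cases hex : ∃ i m, (ω.coeff i).coeff m ≠ 0
  · obtain ⟨i, m, hm⟩ := hex
    refine ⟨m 0 + m 1 + ![1, 1, 0] i, fun j n hn => ?_⟩
    have h1 := (key j n hn).trans (key i m hm).symm
    have h2 := mul_left_cancel₀ hk h1
    have h3 : (2 : ℕ) ^ (n 0 + n 1 + ![1, 1, 0] j) = 2 ^ (m 0 + m 1 + ![1, 1, 0] i) := by
      exact_mod_cast h2
    exact Nat.pow_right_injective le_rfl h3
  · push Not at hex
    exact ⟨0, fun i m hm => absurd (hex i m) hm⟩

theorem Foliation.IsHomogeneous.exists_isCone {F : Foliation 4} (h : F.IsHomogeneous) :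
    ∃ g a b, (F.pullback g).IsCone a b := by
  obtain ⟨g, hg⟩ := h
  obtain ⟨ω, hω⟩ := Quotient.exists_rep (F.pullback g)
  refine ⟨g, ?_⟩
  have h2 := hg (Units.mk0 2 two_ne_zero)
  rw [← hω] at h2 ⊢
  obtain ⟨w, hw⟩ := FoliationForm.exists_weight h2
  have hdeg : ∀ i m, (ω.coeff i).coeff m ≠ 0 → m 0 + m 1 + m 2 = 5 := by
    intro i m hm
    by_contra hne
    refine hm ((ω.homogeneous i).coeff_eq_zero ?_)
    rwa [Finsupp.degree_eq_sum, Fin.sum_univ_three]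
  have he := ω.euler
  rw [Fin.sum_univ_three] at he
  rcases lt_trichotomy w 5 with hw5 | rfl | hw5
  · exfalso
    have hX : IsUnit (X 2 : MvPolynomial (Fin 3) ℂ) := by
      refine ω.coprime _ fun i => X_two_dvd fun m hm => ?_
      have := hw i m hm
      have := hdeg i m hm
      omega
    exact (X_prime (R := ℂ) (i := (2 : Fin 3))).not_isUnit hX
  · obtain ⟨a, ha⟩ := exists_eq_X_two_mul_quartic (p := ω.coeff 0) fun m hm => by
      have := hw 0 m hm
      have := hdeg 0 m hm
      simp at *
      omega
    obtain ⟨b, hb⟩ := exists_eq_X_two_mul_quartic (p := ω.coeff 1) fun m hm => by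
      have := hw 1 m hm
      have := hdeg 1 m hm
      simp at *
      omega
    refine ⟨a, b, ω, rfl, ?_⟩
    have h3 : ω.coeff 2 = -(X 0 * quartic a + X 1 * quartic b) := by
      apply mul_left_cancel₀ (X_ne_zero (R := ℂ) (2 : Fin 3))
      rw [ha, hb] at he
      linear_combination he
    ext1 i
    fin_cases i
    · exact ha
    · exact hb
    · exact h3
  · exfalso
    have h3 : ω.coeff 2 = 0 := by
      ext m
      by_contra hm
      have := hw 2 m (by simpa using hm)
      have := hdeg 2 m (by simpa using hm)
      simp at *
      omega
    rw [h3, mul_zero, add_zero] at he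
    have hd : (X 0 : MvPolynomial (Fin 3) ℂ) ∣ X 1 * ω.coeff 1 :=
      ⟨-ω.coeff 0, by linear_combination he⟩
    rcases (X_prime (R := ℂ) (i := (0 : Fin 3))).dvd_or_dvd hd with hd | ⟨r, hr⟩
    · simp [X_dvd_X] at hd
    · have hr0 : ω.coeff 0 = -(X 1 * r) := by
        apply mul_left_cancel₀ (X_ne_zero (R := ℂ) (0 : Fin 3))
        rw [hr] at he
        linear_combination he
      have hu : IsUnit r := by
        refine ω.coprime r fun i => ?_
        fin_cases i
        · exact ⟨-X 1, by simp only [Fin.zero_eta]; rw [hr0]; ring⟩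
        · exact ⟨X 0, by simp only [Fin.mk_one]; rw [hr]; ring⟩
        · exact ⟨0, by simp only [Fin.reduceFinMk]; rw [h3]; ring⟩
      obtain ⟨c, hc, rfl⟩ := isUnit_iff_eq_C_of_isReduced.1 hu
      have hh := ω.homogeneous 1
      rw [hr] at hh
      have hh' := (isHomogeneous_X ℂ (0 : Fin 3)).mul (isHomogeneous_C (Fin 3) c)
      have := hh.inj_right hh' (mul_ne_zero (X_ne_zero _) (C_ne_zero.2 hc.ne_zero))
      omega

/-! ### Inflection divisor and convexity of cones -/

theorem Foliation.IsCone.exists_inflectionEquation {F : Foliation 4} {a b : Fin 5 → ℂ}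
    (hF : F.IsCone a b) : ∃ I, F.IsInflectionEquation I ∧
      ∀ v, eval v I = v 2 * cone a b (v 0) (v 1) * jac a b (v 0) (v 1) / 4 := by
  obtain ⟨ω, rfl, hω⟩ := hF
  refine ⟨inflectionPoly ![-quartic b, quartic a, 0], ⟨ω, _, rfl, ⟨fun i => ?_, ?_⟩, rfl⟩, ?_⟩
  · fin_cases i
    · exact (isHomogeneous_quartic b).neg
    · exact isHomogeneous_quartic a
    · exact isHomogeneous_zero _ _ _
  · rw [hω]
    ext1 i
    fin_cases i <;> simp [cross_apply]
    · ring
    · ring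
    · ring
  · intro v
    simp [inflectionPoly_eq, alongField, Fin.sum_univ_three, eval_quartic, pderiv_two_quartic,
      eval_pderiv_zero_quartic, eval_pderiv_one_quartic]
    simp only [cone, jac, qval, qdx, qdy]
    ring

/-- The critical points of the rational map defined by a convex cone are fixed. -/
theorem Foliation.IsCone.cone_eq_zero {F : Foliation 4} {a b : Fin 5 → ℂ} (hF : F.IsCone a b)
    (hc : F.IsConvex) {p q : ℂ} (h : jac a b p q = 0) : cone a b p q = 0 := by
  obtain ⟨I, hI, hev⟩ := hF.exists_inflectionEquation
  obtain ⟨c, s, hc0, hJ, hs⟩ := hc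
  obtain ⟨k, hk, hk'⟩ := hI.unique hJ
  have h1 : (s.map fun u => (Polynomial.C (u 0 * p + u 1 * q)
      + Polynomial.C (u 2) * Polynomial.X : Polynomial ℂ)).prod = 0 := by
    apply Polynomial.funext
    intro z
    have h2 := congrArg (eval ![p, q, z]) hk'
    rw [map_mul, map_mul, hev, eval_C, map_multiset_prod, Multiset.map_map] at h2
    simp only [Matrix.cons_val, h, mul_zero, zero_div, mul_eq_zero, hc0, false_or] at h2
    rw [Polynomial.eval_multiset_prod, Multiset.map_map, Polynomial.eval_zero, ← h2]
    congr 2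
    ext1 u
    simp [linForm_eq_sum]
  obtain ⟨u, hu, hu'⟩ := Multiset.mem_map.1 (Multiset.prod_eq_zero_iff.1 h1)
  have hu2 : u 2 = 0 := by
    have := congrArg (Polynomial.coeff · 1) hu'
    simpa using this
  have hu1 : u 0 * p + u 1 * q = 0 := by
    have := congrArg (Polynomial.coeff · 0) hu'
    simpa using this
  obtain ⟨hu0, η, hη, hd⟩ := hs u hu
  obtain ⟨ω, rfl, hω⟩ := hF
  obtain ⟨l, hl, hl'⟩ := mk_eq_mk_iff.1 hη
  have hd' : ∀ i, eval ![p, q, 1] ((η.coeff ⨯₃ (fun j => C (u j))) i) = 0 := by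
    intro i
    obtain ⟨r, hr⟩ := hd i
    rw [hr, map_mul, linForm_eq_sum]
    simp [hu2, hu1]
  have hev2 : eval ![p, q, 1] (η.coeff 2) * l = -cone a b p q := by
    have h3 := congrArg (eval ![p, q, 1]) (hl' 2)
    rw [hω, map_mul, eval_C] at h3
    simp [eval_quartic] at h3
    rw [cone]
    linear_combination -h3
  have h0 := hd' 0
  have h1 := hd' 1
  simp [cross_apply, hu2] at h0 h1
  by_contra hne
  have hη2 : eval ![p, q, 1] (η.coeff 2) ≠ 0 := by
    intro h
    rw [h, zero_mul] at hev2
    exact hne (neg_eq_zero.1 hev2.symm)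
  apply hu0
  ext i
  fin_cases i
  · exact h1.resolve_left hη2
  · exact h0.resolve_left hη2
  · exact hu2

theorem linForm_dvd_quartic {a : Fin 5 → ℂ} {u : Fin 3 → ℂ} (hu : u ≠ 0) (hu2 : u 2 = 0)
    (h : qval a (u 1) (-u 0) = 0) : linForm u ∣ quartic a := by
  have hl : linForm u = C (u 0) * X 0 - -(C (u 1) * X 1) := by
    rw [linForm_eq_sum, hu2]
    simp
  have hp : ∀ n : ℕ, linForm u ∣ (C (u 0) * X 0) ^ n - (-(C (u 1) * X 1)) ^ n := by
    intro n
    rw [hl]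
    exact sub_dvd_pow_sub_pow _ _ n
  have hC : (C (a 0) * C (u 1) ^ 4 - C (a 1) * C (u 1) ^ 3 * C (u 0)
      + C (a 2) * C (u 1) ^ 2 * C (u 0) ^ 2 - C (a 3) * C (u 1) * C (u 0) ^ 3
      + C (a 4) * C (u 0) ^ 4 : MvPolynomial (Fin 3) ℂ) = 0 := by
    rw [← C_0, ← h, qval]
    simp only [← C_mul, ← C_pow, ← C_add, ← C_sub]
    congr 1
    ring
  have h0 : linForm u ∣ C (u 0) ^ 4 * quartic a := by
    have : C (u 0) ^ 4 * quartic a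
        = C (a 0) * ((C (u 0) * X 0) ^ 4 - (-(C (u 1) * X 1)) ^ 4)
        + C (a 1) * C (u 0) * X 1 * ((C (u 0) * X 0) ^ 3 - (-(C (u 1) * X 1)) ^ 3)
        + C (a 2) * C (u 0) ^ 2 * X 1 ^ 2 * ((C (u 0) * X 0) ^ 2 - (-(C (u 1) * X 1)) ^ 2)
        + C (a 3) * C (u 0) ^ 3 * X 1 ^ 3 * ((C (u 0) * X 0) ^ 1 - (-(C (u 1) * X 1)) ^ 1) := by
      rw [quartic]
      linear_combination X 1 ^ 4 * hC
    rw [this]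
    exact (((hp 4).mul_left _).add ((hp 3).mul_left _)).add ((hp 2).mul_left _) |>.add
      ((hp 1).mul_left _)
  have h1 : linForm u ∣ C (u 1) ^ 4 * quartic a := by
    have : C (u 1) ^ 4 * quartic a
        = C (a 4) * ((C (u 0) * X 0) ^ 4 - (-(C (u 1) * X 1)) ^ 4) * (-1)
        + C (a 3) * C (u 1) * X 0 * ((C (u 0) * X 0) ^ 3 - (-(C (u 1) * X 1)) ^ 3)
        - C (a 2) * C (u 1) ^ 2 * X 0 ^ 2 * ((C (u 0) * X 0) ^ 2 - (-(C (u 1) * X 1)) ^ 2)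
        + C (a 1) * C (u 1) ^ 3 * X 0 ^ 3 * ((C (u 0) * X 0) ^ 1 - (-(C (u 1) * X 1)) ^ 1) := by
      rw [quartic]
      linear_combination X 0 ^ 4 * hC
    rw [this]
    exact ((((hp 4).mul_left _).mul_right _).add ((hp 3).mul_left _)).sub
      ((hp 2).mul_left _) |>.add ((hp 1).mul_left _)
  have hcancel : ∀ c : ℂ, c ≠ 0 → linForm u ∣ C c ^ 4 * quartic a → linForm u ∣ quartic a := by
    intro c hc hd
    have := hd.mul_left (C (c ^ 4)⁻¹)
    rwa [← mul_assoc, ← C_pow, ← C_mul, inv_mul_cancel₀ (pow_ne_zero _ hc), C_1, one_mul] at this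
  by_cases hu0 : u 0 = 0
  · refine hcancel (u 1) (fun hu1 => hu ?_) h1
    ext i
    fin_cases i
    · exact hu0
    · exact hu1
    · exact hu2
  · exact hcancel (u 0) hu0 h0

/-- The lines through the origin of the chart contained in the tangent cone are invariant. -/
theorem Foliation.IsCone.isInvariantLine {F : Foliation 4} {a b : Fin 5 → ℂ} (hF : F.IsCone a b)
    {u : Fin 3 → ℂ} (hu : u ≠ 0) (hu2 : u 2 = 0) (h : cone a b (u 1) (-u 0) = 0) :
    F.IsInvariantLine u := by
  obtain ⟨ω, rfl, hω⟩ := hF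
  refine ⟨hu, ω, rfl, ?_⟩
  have hW : linForm u ∣ C (u 1) * quartic a - C (u 0) * quartic b := by
    have h1 := linForm_dvd_quartic (a := fun j => u 1 * a j - u 0 * b j) hu hu2 (by
      rw [cone] at h
      simp only [qval] at h ⊢
      linear_combination h)
    convert h1 using 1
    simp only [quartic, C_sub, C_mul]
    ring
  have hl : linForm u = C (u 0) * X 0 + C (u 1) * X 1 := by
    rw [linForm_eq_sum, hu2]
    simp
  have h0 : linForm u ∣ C (u 0) * (X 0 * quartic a + X 1 * quartic b) := by
    have : C (u 0) * (X 0 * quartic a + X 1 * quartic b)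
        = linForm u * quartic a - X 1 * (C (u 1) * quartic a - C (u 0) * quartic b) := by
      rw [hl]
      ring
    rw [this]
    exact (dvd_mul_right _ _).sub (hW.mul_left _)
  have h1 : linForm u ∣ C (u 1) * (X 0 * quartic a + X 1 * quartic b) := by
    have : C (u 1) * (X 0 * quartic a + X 1 * quartic b)
        = linForm u * quartic b + X 0 * (C (u 1) * quartic a - C (u 0) * quartic b) := by
      rw [hl]
      ring
    rw [this]
    exact (dvd_mul_right _ _).add (hW.mul_left _)
  intro i
  rw [hω]
  fin_cases i
  · simp [cross_apply, hu2]
    convert h1.neg_right using 1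
    ring
  · simp [cross_apply, hu2]
    convert h0.neg_right using 1
    ring
  · simp [cross_apply]
    convert hW.mul_left (X 2) using 1
    ring

/-- The line at infinity of the chart is invariant by a cone. -/
theorem Foliation.IsCone.isInvariantLine_infinity {F : Foliation 4} {a b : Fin 5 → ℂ}
    (hF : F.IsCone a b) : F.IsInvariantLine ![0, 0, 1] := by
  obtain ⟨ω, rfl, hω⟩ := hF
  refine ⟨fun h => one_ne_zero (congrFun h 2), ω, rfl, fun i => ?_⟩
  have hl : linForm ![0, 0, 1] = X 2 := by simp [linForm_eq_sum]
  rw [hω, hl]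
  fin_cases i <;> simp [cross_apply]

theorem Foliation.IsCone.isConvex {F : Foliation 4} {a b : Fin 5 → ℂ} (hF : F.IsCone a b)
    {c : ℂ} (hc : c ≠ 0) (s : Multiset (ℂ × ℂ)) (hs0 : ∀ u ∈ s, u ≠ 0)
    (hs : ∀ u ∈ s, cone a b u.2 (-u.1) = 0)
    (h : ∀ p q, cone a b p q * jac a b p q = c * (s.map fun u => u.1 * p + u.2 * q).prod) :
    F.IsConvex := by
  obtain ⟨I, hI, hev⟩ := hF.exists_inflectionEquation
  refine ⟨c / 4, ![0, 0, 1] ::ₘ s.map (fun u => ![u.1, u.2, 0]), by simpa using hc, ?_, ?_⟩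
  · convert hI using 1
    apply MvPolynomial.funext
    intro v
    rw [hev, mul_assoc, h, Multiset.map_cons, Multiset.prod_cons, map_mul, map_mul,
      map_multiset_prod, Multiset.map_map, Multiset.map_map]
    have hl : (eval v ∘ linForm) ∘ (fun u : ℂ × ℂ => ![u.1, u.2, 0])
        = fun u => u.1 * v 0 + u.2 * v 1 := by
      ext1 u
      simp [linForm_eq_sum]
    rw [hl]
    simp [linForm_eq_sum]
    ring
  · intro u hu
    rcases Multiset.mem_cons.1 hu with rfl | hu
    · exact hF.isInvariantLine_infinity
    · obtain ⟨w, hw, rfl⟩ := Multiset.mem_map.1 hu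
      refine hF.isInvariantLine (fun h => hs0 w hw ?_) rfl (hs w hw)
      exact Prod.ext (congrFun h 0) (congrFun h 1)

/-! ### Homogeneous components and tangency orders -/

section Components

variable {σ : Type*} {M S : MvPolynomial σ ℂ} {n : ℕ}

attribute [local instance] MvPolynomial.gradedAlgebra

theorem coe_decompose_eq_homogeneousComponent (p : MvPolynomial σ ℂ) (i : ℕ) :
    (DirectSum.decompose (homogeneousSubmodule σ ℂ) p i : MvPolynomial σ ℂ)
      = homogeneousComponent i p :=
  decomposition.decompose'_apply p i

theorem homogeneousComponent_mul_add (hM : M.IsHomogeneous n) (i : ℕ) :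
    homogeneousComponent (n + i) (M * S) = M * homogeneousComponent i S := by
  rw [← coe_decompose_eq_homogeneousComponent, ← coe_decompose_eq_homogeneousComponent]
  exact DirectSum.coe_decompose_mul_add_of_left_mem _ ((mem_homogeneousSubmodule _ _).2 hM)

theorem homogeneousComponent_mul_of_lt (hM : M.IsHomogeneous n) {i : ℕ} (hi : i < n) :
    homogeneousComponent i (M * S) = 0 := by
  rw [← coe_decompose_eq_homogeneousComponent]
  exact DirectSum.coe_decompose_mul_of_left_mem_of_not_le _
    ((mem_homogeneousSubmodule _ _).2 hM) (not_le.2 hi)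

theorem homogeneousComponent_mul_self (hM : M.IsHomogeneous n) :
    homogeneousComponent n (M * S) = M * C (eval 0 S) := by
  have h := homogeneousComponent_mul_add (S := S) hM 0
  rw [add_zero, homogeneousComponent_zero] at h
  rw [h, ← constantCoeff_eq, ← eval_zero]

end Components

theorem tangency_det_eq (A B : MvPolynomial (Fin 2) ℂ) (k : ℕ) :
    Matrix.det !![jet k B, X 0; -jet k A, (X 1 : MvPolynomial (Fin 2) ℂ)]
      = ∑ i ∈ Finset.range (k + 1), homogeneousComponent (i + 1) (X 0 * A + X 1 * B) := by
  rw [Matrix.det_fin_two]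
  simp only [Matrix.of_apply, Matrix.cons_val, jet, map_add]
  rw [Finset.sum_add_distrib]
  have h : ∀ (j : Fin 2) (p : MvPolynomial (Fin 2) ℂ) (i : ℕ),
      homogeneousComponent (i + 1) (X j * p) = X j * homogeneousComponent i p := by
    intro j p i
    rw [add_comm, homogeneousComponent_mul_add (isHomogeneous_X ℂ j)]
  simp only [h, ← Finset.mul_sum]
  ring

theorem tangency_det_ne_zero_iff (A B : MvPolynomial (Fin 2) ℂ) (k : ℕ) :
    Matrix.det !![jet k B, X 0; -jet k A, (X 1 : MvPolynomial (Fin 2) ℂ)] ≠ 0 ↔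
      ∃ i ≤ k, homogeneousComponent (i + 1) (X 0 * A + X 1 * B) ≠ 0 := by
  rw [tangency_det_eq]
  constructor
  · intro h
    obtain ⟨i, hi, h⟩ := Finset.exists_ne_zero_of_sum_ne_zero h
    exact ⟨i, by simpa [Nat.lt_succ_iff] using hi, h⟩
  · rintro ⟨i, hi, h⟩ h0
    apply h
    have h1 := congrArg (homogeneousComponent (i + 1)) h0
    rw [map_sum, map_zero, Finset.sum_eq_single i] at h1
    · rwa [homogeneousComponent_of_mem (homogeneousComponent_mem _ _), if_pos rfl] at h1
    · intro j _ hj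
      rw [homogeneousComponent_of_mem (homogeneousComponent_mem _ _), if_neg (by omega)]
    · intro hi'
      exact absurd (Finset.mem_range.2 (by omega)) hi'

/-- The tangency order in terms of the lowest degree term of `x A + y B`. -/
theorem tangencyOrder_eq {A B M S : MvPolynomial (Fin 2) ℂ} {n : ℕ}
    (hν : vanishingOrder A B = 1) (hn : 1 ≤ n) (hM : M.IsHomogeneous (n + 1)) (hM0 : M ≠ 0)
    (hS : eval 0 S ≠ 0) (h : X 0 * A + X 1 * B = M * S) : tangencyOrder A B = n := by
  have hset : {k | vanishingOrder A B ≤ k ∧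
      Matrix.det !![jet k B, X 0; -jet k A, (X 1 : MvPolynomial (Fin 2) ℂ)] ≠ 0} = Set.Ici n := by
    ext k
    rw [Set.mem_ofPred_eq, tangency_det_ne_zero_iff, hν, Set.mem_Ici, h]
    constructor
    · rintro ⟨-, i, hi, hne⟩
      by_contra hlt
      exact hne (homogeneousComponent_mul_of_lt hM (by omega))
    · intro hk
      refine ⟨by omega, n, hk, ?_⟩
      rw [homogeneousComponent_mul_self hM]
      exact mul_ne_zero hM0 (C_ne_zero.2 hS)
  rw [tangencyOrder, hset]
  exact csInf_Ici

theorem vanishingOrder_eq_one_iff {A B : MvPolynomial (Fin 2) ℂ} : vanishingOrder A B = 1 ↔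
    (eval 0 A = 0 ∧ eval 0 B = 0) ∧
      (homogeneousComponent 1 A ≠ 0 ∨ homogeneousComponent 1 B ≠ 0) := by
  have h0 : ∀ p : MvPolynomial (Fin 2) ℂ, homogeneousComponent 0 p = 0 ↔ eval 0 p = 0 := by
    intro p
    rw [homogeneousComponent_zero, ← constantCoeff_eq, ← eval_zero, C_eq_zero]
  constructor
  · intro h
    have h1 : 1 ∈ {k | homogeneousComponent k A ≠ 0 ∨ homogeneousComponent k B ≠ 0} := by
      have h1 : vanishingOrder A B ∈ {k | homogeneousComponent k A ≠ 0 ∨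
          homogeneousComponent k B ≠ 0} := by
        refine Nat.sInf_mem (Nat.nonempty_of_pos_sInf ?_)
        change 0 < vanishingOrder A B
        omega
      rwa [h] at h1
    have h2 : 0 ∉ {k | homogeneousComponent k A ≠ 0 ∨ homogeneousComponent k B ≠ 0} := by
      apply Nat.notMem_of_lt_sInf
      change 0 < vanishingOrder A B
      omega
    rw [Set.mem_ofPred_eq, not_or, not_not, not_not, h0, h0] at h2
    exact ⟨h2, h1⟩
  · rintro ⟨⟨hA, hB⟩, h⟩
    apply le_antisymm
    · exact Nat.sInf_le h
    · apply Nat.one_le_iff_ne_zero.2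
      intro hz
      rcases Nat.sInf_eq_zero.1 hz with h2 | h2
      · rw [Set.mem_ofPred_eq, Ne, Ne, h0, h0] at h2
        tauto
      · exact (Set.eq_empty_iff_forall_notMem.1 h2) 1 h

/-! ### Cones in a chart centred at a point -/

/-- The expression of a polynomial in the affine chart given by `g`. -/
def chart (g : GL (Fin 3) ℂ) : MvPolynomial (Fin 3) ℂ →ₐ[ℂ] MvPolynomial (Fin 2) ℂ :=
  dehomogenize.comp (subst g.val)

theorem chart_X (g : GL (Fin 3) ℂ) (i : Fin 3) :
    chart g (X i) = C (g.val i 0) * X 0 + C (g.val i 1) * X 1 + C (g.val i 2) := by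
  simp [chart, subst_X, Fin.sum_univ_three, dehomogenize]

theorem chart_C (g : GL (Fin 3) ℂ) (c : ℂ) : chart g (C c) = C c := by
  simp [chart, dehomogenize]

theorem eval_zero_chart (g : GL (Fin 3) ℂ) (P : MvPolynomial (Fin 3) ℂ) :
    eval 0 (chart g P) = eval (fun i => g.val i 2) P := by
  have : (aeval (0 : Fin 2 → ℂ)).comp (chart g) = aeval (fun i => g.val i 2) := by
    apply MvPolynomial.algHom_ext
    intro i
    simp [chart_X]
  exact DFunLike.congr_fun this P

theorem eq_zero_of_sum_mul_eq_zero {g : GL (Fin 3) ℂ} {w : Fin 3 → ℂ}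
    (h : ∀ j, ∑ i, g.val i j * w i = 0) (i : Fin 3) : w i = 0 := by
  have h1 : w ᵥ* g.val = 0 := by
    ext j
    rw [Pi.zero_apply, ← h j]
    simp only [Matrix.vecMul, dotProduct]
    exact Finset.sum_congr rfl fun i _ => mul_comm (w i) (g.val i j)
  exact congrFun (Matrix.eq_zero_of_vecMul_eq_zero (GL_det_ne_zero g) h1) i

theorem eq_zero_of_sum_C_mul_eq_zero {σ : Type*} {g : GL (Fin 3) ℂ}
    {W : Fin 3 → MvPolynomial σ ℂ} (h : ∀ j, ∑ i, C (g.val i j) * W i = 0) (i : Fin 3) :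
    W i = 0 := by
  ext m
  refine eq_zero_of_sum_mul_eq_zero (g := g) (w := fun i => (W i).coeff m) (fun j => ?_) i
  rw [← coeff_zero m, ← h j, coeff_sum]
  exact Finset.sum_congr rfl fun i _ => (coeff_C_mul _ _ _).symm

/-- A line through the centre of the chart has a linear equation in the chart. -/
theorem chart_linForm {g : GL (Fin 3) ℂ} {u : Fin 3 → ℂ} (hu : u ≠ 0)
    (h : u 0 * g.val 0 2 + u 1 * g.val 1 2 + u 2 * g.val 2 2 = 0) :
    (chart g (linForm u)).IsHomogeneous 1 ∧ chart g (linForm u) ≠ 0 := by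
  have h1 : chart g (linForm u) = C ((u ᵥ* g.val) 0) * X 0 + C ((u ᵥ* g.val) 1) * X 1 := by
    have h2 : (C (u 0) * C (g.val 0 2) + C (u 1) * C (g.val 1 2) + C (u 2) * C (g.val 2 2)
        : MvPolynomial (Fin 2) ℂ) = 0 := by
      rw [← C_0, ← h]
      simp only [C_add, C_mul]
    simp only [linForm_eq_sum, map_add, map_mul, chart_C, chart_X, Matrix.vecMul, dotProduct,
      Fin.sum_univ_three]
    linear_combination h2
  refine ⟨?_, fun h0 => ?_⟩
  · rw [h1]
    exact ((isHomogeneous_X _ _).C_mul _).add ((isHomogeneous_X _ _).C_mul _)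
  · rw [h1] at h0
    have e0 : (u ᵥ* g.val) 0 = 0 := by
      have := congrArg (eval ![1, 0]) h0
      simpa using this
    have e1 : (u ᵥ* g.val) 1 = 0 := by
      have := congrArg (eval ![0, 1]) h0
      simpa using this
    apply hu
    refine Matrix.eq_zero_of_vecMul_eq_zero (GL_det_ne_zero g) ?_
    ext j
    fin_cases j
    · exact e0
    · exact e1
    · simpa [Matrix.vecMul, dotProduct, Fin.sum_univ_three] using h

/-- The coefficients of the homogeneous form defining a cone, in a chart. -/
def chartCoeff (g : GL (Fin 3) ℂ) (a b : Fin 5 → ℂ) : Fin 3 → MvPolynomial (Fin 2) ℂ :=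
  ![chart g (X 2 * quartic a), chart g (X 2 * quartic b),
    chart g (-(X 0 * quartic a + X 1 * quartic b))]

theorem Foliation.IsCone.exists_describedBy {F : Foliation 4} {a b : Fin 5 → ℂ}
    (hF : F.IsCone a b) (g : GL (Fin 3) ℂ) : ∃ η, (F.pullback g).IsDescribedBy η := by
  obtain ⟨ω, rfl, hω⟩ := hF
  exact ⟨![_, _], ω.pullback g, rfl, rfl, rfl⟩

/-- The affine form of a cone in the chart given by `g`. By the Euler condition, `x A + y B` only
involves the value of the form on the vector defining the centre of the chart. -/
theorem Foliation.IsCone.describedBy {F : Foliation 4} {a b : Fin 5 → ℂ} (hF : F.IsCone a b)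
    {g : GL (Fin 3) ℂ} {η : Fin 2 → MvPolynomial (Fin 2) ℂ}
    (hη : (F.pullback g).IsDescribedBy η) : ∃ k : ℂ, k ≠ 0 ∧
      η 0 = C k * ∑ i, C (g.val i 0) * chartCoeff g a b i ∧
      η 1 = C k * ∑ i, C (g.val i 1) * chartCoeff g a b i ∧
      X 0 * η 0 + X 1 * η 1 = -(C k * ∑ i, C (g.val i 2) * chartCoeff g a b i) := by
  obtain ⟨ω, rfl, hω⟩ := hF
  obtain ⟨ξ, hξ, h0, h1⟩ := hη
  obtain ⟨k, hk, h⟩ := mk_eq_mk_iff.1 hξ.symm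
  have hW : ∀ i, chartCoeff g a b i = chart g (ω.coeff i) := by
    intro i
    rw [hω]
    fin_cases i <;> rfl
  have key : ∀ j, dehomogenize (ξ.coeff j) = C k * ∑ i, C (g.val i j) * chartCoeff g a b i := by
    intro j
    have hd : ∀ c : ℂ, dehomogenize (C c) = C c := fun c => by simp [dehomogenize]
    rw [h j, map_mul, hd]
    simp only [FoliationForm.pullback, pullbackCoeff, map_sum, map_mul, hd, hW]
    rfl
  have k0 := h0.symm.trans (key 0)
  have k1 := h1.symm.trans (key 1)
  refine ⟨k, hk, k0, k1, ?_⟩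
  have he := congrArg (chart g) ω.euler
  rw [Fin.sum_univ_three, map_zero, map_add, map_add, map_mul, map_mul, map_mul, ← hW, ← hW, ← hW,
    chart_X, chart_X, chart_X] at he
  rw [k0, k1, Fin.sum_univ_three, Fin.sum_univ_three, Fin.sum_univ_three]
  linear_combination C k * he

theorem sum_mul_chartCoeff {g : GL (Fin 3) ℂ} (a b : Fin 5 → ℂ) (h2 : g.val 2 2 = 0) :
    ∑ i, C (g.val i 2) * chartCoeff g a b i
      = chart g (X 2) * chart g (C (g.val 0 2) * quartic a + C (g.val 1 2) * quartic b) := by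
  rw [Fin.sum_univ_three, h2]
  simp only [chartCoeff, Matrix.cons_val, map_mul, map_add, chart_C, C_0]
  ring

theorem chart_X_two {g : GL (Fin 3) ℂ} (h2 : g.val 2 2 = 0) :
    (chart g (X 2)).IsHomogeneous 1 ∧ chart g (X 2) ≠ 0 := by
  have h := chart_linForm (g := g) (u := ![0, 0, 1]) (fun h => one_ne_zero (congrFun h 2))
    (by simp [h2])
  have hl : linForm ![0, 0, 1] = X 2 := by simp [linForm_eq_sum]
  rwa [hl] at h

/-- The vanishing and tangency orders of a cone at a point `v` at infinity, where `v₀ A + v₁ B`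
vanishes to order exactly `m`. -/
theorem Foliation.IsCone.orders_eq {F : Foliation 4} {a b : Fin 5 → ℂ} (hF : F.IsCone a b)
    (hcop : ∀ p q, qval a p q = 0 → qval b p q = 0 → p = 0 ∧ q = 0)
    {g : GL (Fin 3) ℂ} {η : Fin 2 → MvPolynomial (Fin 2) ℂ}
    (hη : (F.pullback g).IsDescribedBy η) (h2 : g.val 2 2 = 0) {u : Fin 3 → ℂ} (hu : u ≠ 0)
    (hug : u 0 * g.val 0 2 + u 1 * g.val 1 2 + u 2 * g.val 2 2 = 0) {m : ℕ} (hm : 1 ≤ m)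
    {S : MvPolynomial (Fin 3) ℂ} (hS : eval (fun i => g.val i 2) S ≠ 0)
    (h : C (g.val 0 2) * quartic a + C (g.val 1 2) * quartic b = linForm u ^ m * S) :
    vanishingOrder (η 0) (η 1) = 1 ∧ tangencyOrder (η 0) (η 1) = m := by
  obtain ⟨k, hk, hη0, hη1, hT⟩ := hF.describedBy hη
  obtain ⟨hL, hL0⟩ := chart_linForm hu hug
  obtain ⟨hZ, hZ0⟩ := chart_X_two h2
  have hM : (chart g (X 2) * chart g (linForm u) ^ m).IsHomogeneous (m + 1) := by
    have := hZ.mul (hL.pow m)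
    rwa [one_mul, add_comm] at this
  have hM0 : chart g (X 2) * chart g (linForm u) ^ m ≠ 0 := mul_ne_zero hZ0 (pow_ne_zero _ hL0)
  have hT' : ∑ i, C (g.val i 2) * chartCoeff g a b i
      = chart g (X 2) * chart g (linForm u) ^ m * chart g S := by
    rw [sum_mul_chartCoeff a b h2, h, map_mul, map_pow, mul_assoc]
  have hev : eval (fun i => g.val i 2) (linForm u) = 0 := by
    simp [linForm_eq_sum]
    linear_combination hug
  have hν : vanishingOrder (η 0) (η 1) = 1 := by
    rw [vanishingOrder_eq_one_iff]
    constructor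
    · have hc : ∀ i, eval 0 (chartCoeff g a b i) = 0 := by
        have hQ := congrArg (eval (fun i => g.val i 2)) h
        rw [map_mul, map_pow, hev, zero_pow (by omega), zero_mul] at hQ
        intro i
        fin_cases i
        · simp only [chartCoeff, Fin.zero_eta, Matrix.cons_val, eval_zero_chart]
          simp [h2]
        · simp only [chartCoeff, Fin.mk_one, Matrix.cons_val, eval_zero_chart]
          simp [h2]
        · simp only [chartCoeff, Fin.reduceFinMk, Matrix.cons_val, eval_zero_chart]
          simp at hQ ⊢
          linear_combination -hQ
      rw [hη0, hη1]
      simp [hc, -eval_zero]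
    · by_contra hcon
      rw [not_or, not_not, not_not, hη0, hη1, homogeneousComponent_C_mul,
        homogeneousComponent_C_mul] at hcon
      have hW := eq_zero_of_sum_C_mul_eq_zero (g := g)
        (W := fun i => homogeneousComponent 1 (chartCoeff g a b i)) (fun j => by
          simp only [← homogeneousComponent_C_mul, ← map_sum]
          fin_cases j
          · exact (mul_eq_zero.1 hcon.1).resolve_left (C_ne_zero.2 hk)
          · exact (mul_eq_zero.1 hcon.2).resolve_left (C_ne_zero.2 hk)
          · simp only [Fin.reduceFinMk]
            rw [hT', homogeneousComponent_mul_of_lt hM (by omega)])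
      have hval : ∀ c : Fin 5 → ℂ, homogeneousComponent 1 (chart g (X 2 * quartic c)) = 0 →
          qval c (g.val 0 2) (g.val 1 2) = 0 := by
        intro c hc
        rw [map_mul, homogeneousComponent_mul_self hZ, eval_zero_chart, eval_quartic] at hc
        exact C_eq_zero.1 ((mul_eq_zero.1 hc).resolve_left hZ0)
      obtain ⟨e0, e1⟩ := hcop _ _ (hval a (hW 0)) (hval b (hW 1))
      apply hS
      have hdet := GL_det_ne_zero g
      exact absurd (by rw [Matrix.det_fin_three, e0, e1, h2]; ring) hdet
  refine ⟨hν, tangencyOrder_eq (S := C (-k) * chart g S) hν hm hM hM0 ?_ ?_⟩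
  · rw [map_mul, eval_C, eval_zero_chart]
    exact mul_ne_zero (neg_ne_zero.2 hk) hS
  · rw [hT, hT', C_neg]
    ring

theorem pderiv_dehomogenize_zero (P : MvPolynomial (Fin 3) ℂ) :
    pderiv 0 (dehomogenize P) = dehomogenize (pderiv 0 P) := by
  induction P using MvPolynomial.induction_on with
  | C c => simp [dehomogenize]
  | add p q hp hq => simp only [map_add, hp, hq]
  | mul_X p i hp =>
    rw [map_mul, pderiv_mul, pderiv_mul, map_add, map_mul, map_mul, hp]
    congr 2
    fin_cases i <;> simp [dehomogenize, pderiv_X]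

theorem pderiv_dehomogenize_one (P : MvPolynomial (Fin 3) ℂ) :
    pderiv 1 (dehomogenize P) = dehomogenize (pderiv 1 P) := by
  induction P using MvPolynomial.induction_on with
  | C c => simp [dehomogenize]
  | add p q hp hq => simp only [map_add, hp, hq]
  | mul_X p i hp =>
    rw [map_mul, pderiv_mul, pderiv_mul, map_add, map_mul, map_mul, hp]
    congr 2
    fin_cases i <;> simp [dehomogenize, pderiv_X]

theorem eval_zero_pderiv_eq_zero {p : MvPolynomial (Fin 2) ℂ} (h : homogeneousComponent 1 p = 0)
    (i : Fin 2) : eval 0 (pderiv i p) = 0 := by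
  have h1 : p.coeff (Finsupp.single i 1) = 0 := by
    have := congrArg (MvPolynomial.coeff (Finsupp.single i 1)) h
    rw [coeff_homogeneousComponent, if_pos (by simp)] at this
    simpa using this
  rw [eval_zero, constantCoeff_eq, coeff_pderiv]
  simp [h1]

/-- A radial singularity of a cone lies on the line at infinity, at a point `v` where the gradient
of `v₀ A + v₁ B` vanishes. -/
theorem Foliation.IsCone.gradient_eq_zero {F : Foliation 4} {a b : Fin 5 → ℂ} (hF : F.IsCone a b)
    (hcop : ∀ p q, qval a p q = 0 → qval b p q = 0 → p = 0 ∧ q = 0)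
    {g : GL (Fin 3) ℂ} {η : Fin 2 → MvPolynomial (Fin 2) ℂ}
    (hη : (F.pullback g).IsDescribedBy η) (hν : vanishingOrder (η 0) (η 1) = 1)
    (hτ : 1 < tangencyOrder (η 0) (η 1)) : g.val 2 2 = 0 ∧
      g.val 0 2 * qdx a (g.val 0 2) (g.val 1 2) + g.val 1 2 * qdx b (g.val 0 2) (g.val 1 2) = 0 ∧
      g.val 0 2 * qdy a (g.val 0 2) (g.val 1 2)
        + g.val 1 2 * qdy b (g.val 0 2) (g.val 1 2) = 0 := by
  obtain ⟨k, hk, hη0, hη1, hT⟩ := hF.describedBy hη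
  obtain ⟨⟨hA, hB⟩, hlin⟩ := vanishingOrder_eq_one_iff.1 hν
  have hcoeff : ∀ i, eval 0 (chartCoeff g a b i) = 0 := by
    refine eq_zero_of_sum_mul_eq_zero (g := g) fun j => ?_
    have hT0 := congrArg (eval 0) hT
    rw [hη0] at hA
    rw [hη1] at hB
    simp [hk, -eval_zero] at hA hB hT0
    fin_cases j
    · exact hA
    · exact hB
    · exact hT0
  have h2 : g.val 2 2 = 0 := by
    by_contra h2
    have hval : ∀ c : Fin 5 → ℂ, eval 0 (chart g (X 2 * quartic c)) = 0 →
        qval c (g.val 0 2) (g.val 1 2) = 0 := by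
      intro c hc
      rw [eval_zero_chart, map_mul, eval_X, eval_quartic] at hc
      exact (mul_eq_zero.1 hc).resolve_left h2
    obtain ⟨e0, e1⟩ := hcop _ _ (hval a (hcoeff 0)) (hval b (hcoeff 1))
    have hX0 : (chart g (X 0)).IsHomogeneous 1 := by
      rw [chart_X, e0, C_0, add_zero]
      exact ((isHomogeneous_X _ _).C_mul _).add ((isHomogeneous_X _ _).C_mul _)
    have hX1 : (chart g (X 1)).IsHomogeneous 1 := by
      rw [chart_X, e1, C_0, add_zero]
      exact ((isHomogeneous_X _ _).C_mul _).add ((isHomogeneous_X _ _).C_mul _)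
    -- at the origin of the chart `z = 1` the form vanishes to order greater than `1`
    have hq : ∀ (c : Fin 5 → ℂ) (P : MvPolynomial (Fin 3) ℂ),
        homogeneousComponent 1 (chart g (P * quartic c)) = 0 := by
      intro c P
      have h4 : P * quartic c
          = X 0 * X 0 * (P * (C (c 0) * X 0 ^ 2 + C (c 1) * X 0 * X 1 + C (c 2) * X 1 ^ 2))
            + X 1 * X 1 * (P * (C (c 3) * X 0 * X 1 + C (c 4) * X 1 ^ 2)) := by
        rw [quartic]
        ring
      rw [h4, map_add, map_mul (chart g) (X 0 * X 0), map_mul (chart g) (X 1 * X 1),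
        map_mul (chart g) (X 0) (X 0), map_mul (chart g) (X 1) (X 1), map_add,
        homogeneousComponent_mul_of_lt (hX0.mul hX0) (by norm_num),
        homogeneousComponent_mul_of_lt (hX1.mul hX1) (by norm_num), add_zero]
    have hc1 : ∀ i, homogeneousComponent 1 (chartCoeff g a b i) = 0 := by
      intro i
      fin_cases i
      · exact hq a (X 2)
      · exact hq b (X 2)
      · simp only [chartCoeff, Fin.reduceFinMk, Matrix.cons_val]
        rw [map_neg, map_add, map_neg, map_add, hq, hq, add_zero, neg_zero]
    rw [hη0, hη1, homogeneousComponent_C_mul, homogeneousComponent_C_mul] at hlin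
    simp only [map_sum, homogeneousComponent_C_mul, hc1, mul_zero, Finset.sum_const_zero, ne_eq,
      not_true_eq_false, or_self] at hlin
  refine ⟨h2, ?_⟩
  set Q := C (g.val 0 2) * quartic a + C (g.val 1 2) * quartic b with hQdef
  have hQ0 : eval (fun i => g.val i 2) Q = 0 := by
    have h3 := hcoeff 2
    simp only [chartCoeff, Matrix.cons_val, eval_zero_chart] at h3
    simp [hQdef] at h3 ⊢
    linear_combination -h3
  have hQ1 : homogeneousComponent 1 (chart g Q) = 0 := by
    have h3 : (1 : ℕ) ∉ {k | vanishingOrder (η 0) (η 1) ≤ k ∧ Matrix.det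
        !![jet k (η 1), X 0; -jet k (η 0), (X 1 : MvPolynomial (Fin 2) ℂ)] ≠ 0} :=
      Nat.notMem_of_lt_sInf hτ
    rw [Set.mem_ofPred_eq, not_and, tangency_det_ne_zero_iff] at h3
    have h4 := h3 hν.le
    push Not at h4
    have h5 := h4 1 le_rfl
    obtain ⟨hZ, hZ0⟩ := chart_X_two h2
    rw [hT, sum_mul_chartCoeff a b h2, map_neg, homogeneousComponent_C_mul,
      homogeneousComponent_mul_add hZ 1] at h5
    exact ((mul_eq_zero.1 ((mul_eq_zero.1 (neg_eq_zero.1 h5)).resolve_left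
      (C_ne_zero.2 hk))).resolve_left hZ0)
  have hgrad : ∀ i, eval (fun i => g.val i 2) (pderiv i Q) = 0 := by
    refine eq_zero_of_sum_mul_eq_zero (g := g) fun j => ?_
    have hch : ∀ j, eval 0 (dehomogenize (pderiv j (subst g.val Q)))
        = ∑ i, g.val i j * eval (fun i => g.val i 2) (pderiv i Q) := by
      intro j
      rw [pderiv_subst, map_sum, map_sum]
      refine Finset.sum_congr rfl fun i _ => ?_
      rw [map_mul, map_mul, ← eval_zero_chart]
      congr 1
      simp [dehomogenize]
    fin_cases j
    · rw [← eval_zero_pderiv_eq_zero hQ1 0]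
      exact (hch 0).symm.trans (by rw [← pderiv_dehomogenize_zero]; rfl)
    · rw [← eval_zero_pderiv_eq_zero hQ1 1]
      exact (hch 1).symm.trans (by rw [← pderiv_dehomogenize_one]; rfl)
    · have hQh : Q.IsHomogeneous 4 :=
        ((isHomogeneous_quartic a).C_mul _).add ((isHomogeneous_quartic b).C_mul _)
      have h3 := congrArg (eval (fun i => g.val i 2)) hQh.sum_X_mul_pderiv
      rw [map_nsmul, hQ0, smul_zero] at h3
      rw [← h3, map_sum]
      exact Finset.sum_congr rfl fun i _ => by simp
  have h3 := hgrad 0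
  have h4 := hgrad 1
  rw [hQdef, map_add, pderiv_C_mul, pderiv_C_mul, map_add, map_mul, map_mul, eval_C, eval_C]
    at h3 h4
  rw [eval_pderiv_zero_quartic, eval_pderiv_zero_quartic] at h3
  rw [eval_pderiv_one_quartic, eval_pderiv_one_quartic] at h4
  exact ⟨h3, h4⟩

/-! ### Counting radial singularities -/

theorem eq_mk_of_mem_submodule {s : ℙ ℂ (Fin 3 → ℂ)} {v : Fin 3 → ℂ} (hv : v ≠ 0)
    (h : v ∈ s.submodule) : s = Projectivization.mk ℂ v hv := by
  induction s using Projectivization.ind with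
  | h w hw =>
    rw [Projectivization.submodule_mk] at h
    obtain ⟨c, rfl⟩ := Submodule.mem_span_singleton.1 h
    exact ((Projectivization.mk_eq_mk_iff' ℂ _ _ hv hw).2 ⟨c, rfl⟩).symm

theorem exists_GL_column {p q : ℂ} (h : (p, q) ≠ 0) :
    ∃ g : GL (Fin 3) ℂ, g.val 0 2 = p ∧ g.val 1 2 = q ∧ g.val 2 2 = 0 := by
  by_cases hp : p = 0
  · have hq : q ≠ 0 := fun hq => h (by simp [hp, hq])
    exact ⟨Matrix.GeneralLinearGroup.mkOfDetNeZero !![1, 0, p; 0, 0, q; 0, 1, 0] (by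
      rw [Matrix.det_fin_three]
      simpa using hq), rfl, rfl, rfl⟩
  · exact ⟨Matrix.GeneralLinearGroup.mkOfDetNeZero !![0, 0, p; 1, 0, q; 0, 1, 0] (by
      rw [Matrix.det_fin_three]
      simpa using hp), rfl, rfl, rfl⟩

theorem mulVec_last (g : GL (Fin 3) ℂ) : g.val *ᵥ ![0, 0, 1] = fun i => g.val i 2 := by
  ext i
  simp [Matrix.mulVec, dotProduct, Fin.sum_univ_three]

/-- The point at infinity `[v₀ : v₁ : 0]`. -/
def pointAt (v : ℂ × ℂ) (hv : v ≠ 0) : ℙ ℂ (Fin 3 → ℂ) :=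
  Projectivization.mk ℂ ![v.1, v.2, 0] fun h => hv (Prod.ext (congrFun h 0) (congrFun h 1))

/-- The number of radial singularities of order `k` of a cone, given the list of the points `v` at
infinity where `v₀ A + v₁ B` vanishes to order at least `2`, together with these orders. -/
theorem Foliation.IsCone.ncard_isRadialOfOrder {F : Foliation 4} {a b : Fin 5 → ℂ}
    (hF : F.IsCone a b) (hcop : ∀ p q, qval a p q = 0 → qval b p q = 0 → p = 0 ∧ q = 0)
    {n : ℕ} (pt : Fin n → ℂ × ℂ) (ord : Fin n → ℕ) (hpt : ∀ j, pt j ≠ 0)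
    (hinj : ∀ i j, i ≠ j → (pt i).1 * (pt j).2 - (pt i).2 * (pt j).1 ≠ 0)
    (hord : ∀ j, ∃ S : MvPolynomial (Fin 3) ℂ, C (pt j).1 * quartic a + C (pt j).2 * quartic b
      = linForm ![(pt j).2, -(pt j).1, 0] ^ (ord j + 1) * S ∧
        ∀ c, c ≠ 0 → eval ![c * (pt j).1, c * (pt j).2, 0] S ≠ 0)
    (hlist : ∀ p q, p * qdx a p q + q * qdx b p q = 0 → p * qdy a p q + q * qdy b p q = 0 →
      ∃ j c, p = c * (pt j).1 ∧ q = c * (pt j).2) {k : ℕ} (hk : 1 ≤ k) :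
    Set.ncard {s | F.IsRadialOfOrder s k} = (Finset.univ.filter fun j => ord j = k).card := by
  have horders : ∀ (j : Fin n) (g : GL (Fin 3) ℂ) (η : Fin 2 → MvPolynomial (Fin 2) ℂ) (c : ℂ),
      (F.pullback g).IsDescribedBy η → c ≠ 0 → g.val 0 2 = c * (pt j).1 →
      g.val 1 2 = c * (pt j).2 → g.val 2 2 = 0 →
      vanishingOrder (η 0) (η 1) = 1 ∧ tangencyOrder (η 0) (η 1) = ord j + 1 := by
    intro j g η c hη hc h0 h1 h2
    obtain ⟨S, hS, hS0⟩ := hord j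
    refine hF.orders_eq hcop hη h2 (u := ![(pt j).2, -(pt j).1, 0]) (S := C c * S) ?_ ?_
      (by omega) ?_ ?_
    · intro h
      exact hpt j (Prod.ext (by simpa using congrFun h 1) (by simpa using congrFun h 0))
    · simp [h0, h1]
      ring
    · have hv : (fun i => g.val i 2) = ![c * (pt j).1, c * (pt j).2, 0] := by
        ext i
        fin_cases i
        · exact h0
        · exact h1
        · exact h2
      rw [hv, map_mul, eval_C]
      exact mul_ne_zero hc (hS0 c hc)
    · rw [h0, h1, C_mul, C_mul]
      linear_combination C c * hS
  have hset : {s | F.IsRadialOfOrder s k}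
      = (fun j => pointAt (pt j) (hpt j)) '' {j | ord j = k} := by
    ext s
    constructor
    · rintro ⟨g, η, hs, hη, hν, hτ⟩
      rw [mulVec_last] at hs
      obtain ⟨h2, hx, hy⟩ := hF.gradient_eq_zero hcop hη hν (by omega)
      obtain ⟨j, c, h0, h1⟩ := hlist _ _ hx hy
      have hc : c ≠ 0 := by
        rintro rfl
        exact GL_det_ne_zero g (by rw [Matrix.det_fin_three, h0, h1, h2]; ring)
      obtain ⟨-, hτ'⟩ := horders j g η c hη hc h0 h1 h2
      refine ⟨j, by rw [Set.mem_ofPred_eq]; omega, ?_⟩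
      refine (eq_mk_of_mem_submodule _ ?_).symm
      have hv : ![(pt j).1, (pt j).2, 0] = c⁻¹ • fun i => g.val i 2 := by
        ext i
        fin_cases i
        · simp [h0, hc]
        · simp [h1, hc]
        · simp [h2]
      rw [hv]
      exact Submodule.smul_mem _ _ hs
    · rintro ⟨j, hj, rfl⟩
      obtain ⟨g, h0, h1, h2⟩ := exists_GL_column (p := (pt j).1) (q := (pt j).2) (hpt j)
      obtain ⟨η, hη⟩ := hF.exists_describedBy g
      obtain ⟨hν, hτ⟩ := horders j g η 1 hη one_ne_zero (by simpa using h0) (by simpa using h1) h2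
      refine ⟨g, η, ?_, hη, hν, by rw [hτ, hj]⟩
      rw [mulVec_last]
      simp only [pointAt, Projectivization.submodule_mk]
      convert Submodule.mem_span_singleton_self _ using 1
      ext i
      fin_cases i
      · exact h0
      · exact h1
      · exact h2
  have hinj' : Function.Injective fun j => pointAt (pt j) (hpt j) := by
    intro i j h
    by_contra hij
    obtain ⟨c, hc⟩ := (Projectivization.mk_eq_mk_iff' ℂ _ _ _ _).1 h
    have h0 : c * (pt j).1 = (pt i).1 := congrFun hc 0
    have h1 : c * (pt j).2 = (pt i).2 := congrFun hc 1
    apply hinj i j hij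
    rw [← h0, ← h1]
    ring
  rw [hset, Set.ncard_image_of_injective _ hinj', ← Set.ncard_coe_finset]
  congr 1
  ext j
  simp

/-! ### Polynomials in one variable -/

/-- A polynomial with simple roots divides every polynomial vanishing at all of its roots. -/
theorem dvd_of_simple_roots {p q : Polynomial ℂ} (hp : p ≠ 0)
    (hs : ∀ r, p.eval r = 0 → p.derivative.eval r ≠ 0) (h : ∀ r, p.eval r = 0 → q.eval r = 0) :
    p ∣ q := by
  have hsep : p.roots.Nodup := by
    rw [Multiset.nodup_iff_count_le_one]
    intro r
    rw [Polynomial.count_roots]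
    by_contra hr
    push Not at hr
    obtain ⟨h0, h1⟩ := (Polynomial.one_lt_rootMultiplicity_iff_isRoot hp).1 hr
    exact hs r h0 h1
  by_cases hq : q = 0
  · rw [hq]
    exact dvd_zero p
  have hle : p.roots ≤ q.roots := (Multiset.le_iff_subset hsep).2 fun r hr =>
    (Polynomial.mem_roots hq).2 (h r ((Polynomial.mem_roots hp).1 hr))
  have hsp := (IsAlgClosed.splits p).eq_prod_roots
  have hd := (Multiset.prod_X_sub_C_dvd_iff_le_roots hq _).2 hle
  rw [hsp]
  exact (Polynomial.isUnit_C.2 (Polynomial.leadingCoeff_ne_zero.2 hp).isUnit).mul_left_dvd.2 hd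

theorem exists_quadratic_roots (b c : ℂ) : ∃ r s : ℂ, r + s = -b ∧ r * s = c := by
  obtain ⟨d, hd⟩ := IsAlgClosed.exists_pow_nat_eq (b ^ 2 - 4 * c) (n := 2) (by norm_num)
  exact ⟨(-b + d) / 2, (-b - d) / 2, by ring, by linear_combination -hd / 4⟩

/-- The roots of the cubic `x ^ 3 + u x + v`. -/
theorem exists_cubic_roots (u v : ℂ) : ∃ r s t : ℂ,
    r + s + t = 0 ∧ r * s + s * t + t * r = u ∧ r * s * t = -v := by
  obtain ⟨r, hr⟩ : ∃ r : ℂ, r ^ 3 + u * r + v = 0 := by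
    obtain ⟨r, hr⟩ := IsAlgClosed.exists_root
      (Polynomial.X ^ 3 + Polynomial.C u * Polynomial.X + Polynomial.C v : Polynomial ℂ) (by
        rw [show (Polynomial.X ^ 3 + Polynomial.C u * Polynomial.X + Polynomial.C v
          : Polynomial ℂ).degree = 3 by compute_degree!]
        norm_num)
    exact ⟨r, by simpa [Polynomial.IsRoot] using hr⟩
  obtain ⟨s, t, h1, h2⟩ := exists_quadratic_roots r (u + r ^ 2)
  refine ⟨r, s, t, by linear_combination h1, by linear_combination h2 + r * h1, ?_⟩
  linear_combination hr + r * h2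

theorem eq_zero_of_three_roots {a b c r s t : ℂ} (hrs : r ≠ s) (hst : s ≠ t) (hrt : r ≠ t)
    (hr : a * r ^ 2 + b * r + c = 0) (hs : a * s ^ 2 + b * s + c = 0)
    (ht : a * t ^ 2 + b * t + c = 0) : a = 0 ∧ b = 0 ∧ c = 0 := by
  have h1 : a * (r + s) + b = 0 := by
    apply mul_left_cancel₀ (sub_ne_zero.2 hrs)
    linear_combination hr - hs
  have h2 : a * (s + t) + b = 0 := by
    apply mul_left_cancel₀ (sub_ne_zero.2 hst)
    linear_combination hs - ht
  have ha : a = 0 := by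
    apply mul_left_cancel₀ (sub_ne_zero.2 hrt)
    linear_combination h1 - h2
  subst ha
  have hb : b = 0 := by linear_combination h1
  subst hb
  exact ⟨rfl, rfl, by linear_combination hr⟩

/-! ### Normal forms of convex cones -/

/-- The coefficients of the quartic form `A` of each of the five models `A dx + B dy`. -/
def modelA : Fin 5 → Fin 5 → ℂ :=
  ![![0, 0, 0, 0, 1], ![0, 0, 0, 2, -1], ![0, 0, 6, 4, 1], ![0, 0, 0, 4, 1], ![0, 0, 6, 4, 1]]

/-- The coefficients of the quartic form `B` of each of the five models `A dx + B dy`. -/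
def modelB : Fin 5 → Fin 5 → ℂ :=
  ![![-1, 0, 0, 0, 0], ![1, -2, 0, 0, 0], ![-1, -4, 0, 0, 0], ![1, 4, 0, 0, 0], ![3, 0, 0, 0, 0]]

/-- The foliation is conjugate to one of the five models. -/
def Foliation.IsModel (F : Foliation 4) : Prop :=
  ∃ (i : Fin 5) (g : GL (Fin 3) ℂ), (F.pullback g).IsCone (modelA i) (modelB i)

theorem Foliation.IsModel.of_pullback {F : Foliation 4} {g : GL (Fin 3) ℂ}
    (h : (F.pullback g).IsModel) : F.IsModel := by
  obtain ⟨i, g', h⟩ := h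
  exact ⟨i, g * g', by rwa [Foliation.pullback_pullback] at h⟩

/-- The coefficients of `A (x + c y, y)`. -/
def shift (c : ℂ) (a : Fin 5 → ℂ) : Fin 5 → ℂ :=
  ![a 0, a 1 + 4 * a 0 * c, a 2 + 3 * a 1 * c + 6 * a 0 * c ^ 2,
    a 3 + 2 * a 2 * c + 3 * a 1 * c ^ 2 + 4 * a 0 * c ^ 3,
    a 4 + a 3 * c + a 2 * c ^ 2 + a 1 * c ^ 3 + a 0 * c ^ 4]

/-- The coefficients of `A (c x + y, x)`. -/
def flip (c : ℂ) (a : Fin 5 → ℂ) : Fin 5 → ℂ :=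
  ![shift c a 4, shift c a 3, shift c a 2, shift c a 1, shift c a 0]

theorem qval_flip (c : ℂ) (a : Fin 5 → ℂ) (p q : ℂ) :
    qval (flip c a) p q = qval a (c * p + q) p := by
  simp [qval, flip, shift]
  ring

theorem false_of_X_dvd {F : Foliation 4} {a b : Fin 5 → ℂ} (hF : F.IsCone a b) (i : Fin 3)
    (ha : X i ∣ quartic a) (hb : X i ∣ quartic b) : False := by
  obtain ⟨ω, -, hω⟩ := hF
  refine (X_prime (R := ℂ) (i := i)).not_isUnit (ω.coprime (X i) fun j => ?_)
  rw [hω]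
  fin_cases j
  · exact ha.mul_left _
  · exact hb.mul_left _
  · exact ((ha.mul_left _).add (hb.mul_left _)).neg_right

theorem Foliation.IsCone.coeff_zero_ne_zero {F : Foliation 4} {a b : Fin 5 → ℂ}
    (hF : F.IsCone a b) (ha : a 0 = 0) : b 0 ≠ 0 := by
  intro hb
  have h : ∀ c : Fin 5 → ℂ, c 0 = 0 → X 1 ∣ quartic c := fun c hc =>
    ⟨C (c 1) * X 0 ^ 3 + C (c 2) * X 0 ^ 2 * X 1 + C (c 3) * X 0 * X 1 ^ 2 + C (c 4) * X 1 ^ 3, by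
      rw [quartic, hc, C_0]
      ring⟩
  exact false_of_X_dvd hF 1 (h a ha) (h b hb)

theorem Foliation.IsCone.coeff_four_ne_zero {F : Foliation 4} {a b : Fin 5 → ℂ}
    (hF : F.IsCone a b) (ha : a 4 = 0) : b 4 ≠ 0 := by
  intro hb
  have h : ∀ c : Fin 5 → ℂ, c 4 = 0 → X 0 ∣ quartic c := fun c hc =>
    ⟨C (c 0) * X 0 ^ 3 + C (c 1) * X 0 ^ 2 * X 1 + C (c 2) * X 0 * X 1 ^ 2 + C (c 3) * X 1 ^ 3, by
      rw [quartic, hc, C_0]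
      ring⟩
  exact false_of_X_dvd hF 0 (h a ha) (h b hb)

/-- The map is the quartic polynomial with a double critical point at `1` and a simple one at
`-2`, both fixed. -/
theorem isModel_of_double {F : Foliation 4}
    (hF : F.IsCone ![0, 0, 0, 0, 1] ![-1 / 9, 0, 2 / 3, -8 / 9, -2 / 3]) : F.IsModel := by
  refine ⟨2, hF.exists_pullback (k := -1 / 3) (p := -2) (q := 1) (r := 1) (s := 1) (by norm_num)
    (by norm_num) (fun x y => ?_) (fun x y => ?_)⟩
  · simp [qval, modelA]
    ring
  · simp [qval, modelB]
    ring

/-- The map is a quartic polynomial with three distinct fixed critical points, the cube roots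
of `1`. -/
theorem isModel_of_cyclic {F : Foliation 4}
    (hF : F.IsCone ![0, 0, 0, 0, 1] ![1 / 3, 0, 0, -4 / 3, 0]) : F.IsModel := by
  refine ⟨4, hF.exists_pullback (k := 3) (p := 1) (q := 1) (r := 1) (s := 0) (by norm_num)
    (by norm_num) (fun x y => ?_) (fun x y => ?_)⟩
  · simp [qval, modelA]
    ring
  · simp [qval, modelB]

/-- The map has three fixed points of local degree `3`: `[1 : 0]`, `[1 : 1]` and `[-1 : 1]`. -/
theorem isModel_of_three_double {F : Foliation 4}
    (hF : F.IsCone ![0, 0, 0, 1, 0] ![1 / 8, 0, -3 / 4, 0, -3 / 8]) : F.IsModel := by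
  refine ⟨1, hF.exists_pullback (k := 1 / 2) (p := -2) (q := 1) (r := 0) (s := 1) (by norm_num)
    (by norm_num) (fun x y => ?_) (fun x y => ?_)⟩
  · simp [qval, modelA]
    ring
  · simp [qval, modelB]
    ring

/-- The map has two fixed points of local degree `3`: `[1 : 0]` and `[1 : 1]`. The other two
critical points `[r : 1]` are the roots of `r ^ 2 + 10 r + 5`. -/
theorem isModel_of_two_double {F : Foliation 4}
    (hF : F.IsCone ![0, 0, 0, 1, 0] ![1 / 64, 3 / 16, -21 / 32, -5 / 16, -15 / 64]) :
    F.IsModel := by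
  refine ⟨3, hF.exists_pullback (k := -1 / 4) (p := -4) (q := -1) (r := 0) (s := -1)
    (by norm_num) (by norm_num) (fun x y => ?_) (fun x y => ?_)⟩
  · simp [qval, modelA]
    ring
  · simp [qval, modelB]
    ring

/-- The change of coordinates `(x, y) ↦ (c x, y)`, for a map fixing `[1 : 0]` with order `4`. -/
theorem Foliation.IsCone.exists_scale_four {F : Foliation 4} {b : Fin 5 → ℂ}
    (hF : F.IsCone ![0, 0, 0, 0, 1] b) {c : ℂ} (hc : c ≠ 0) (b' : Fin 5 → ℂ)
    (h0 : b' 0 = b 0 * c ^ 3) (h1 : b' 1 = b 1 * c ^ 2) (h2 : b' 2 = b 2 * c) (h3 : b' 3 = b 3)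
    (h4 : b' 4 * c = b 4) :
    ∃ g : GL (Fin 3) ℂ, (F.pullback g).IsCone ![0, 0, 0, 0, 1] b' := by
  refine hF.exists_pullback (k := c⁻¹) (p := c) (q := 0) (r := 0) (s := 1) (inv_ne_zero hc)
    (by simpa using hc) (fun x y => ?_) (fun x y => ?_)
  · simp [qval]
    field_simp
  · simp only [qval, h0, h1, h2, h3, ← h4]
    field_simp
    ring

/-- A quartic polynomial all of whose critical points are fixed, in centred form. -/
theorem isModel_of_centred {F : Foliation 4} {b : Fin 5 → ℂ} (hc : F.IsConvex)
    (hF : F.IsCone ![0, 0, 0, 0, 1] b) (hb0 : b 0 ≠ 0) (hb1 : b 1 = 0) : F.IsModel := by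
  have hcrit : ∀ s, 4 * b 0 * s ^ 3 + 2 * b 2 * s + b 3 = 0 →
      b 0 * s ^ 4 + b 2 * s ^ 2 + b 3 * s + b 4 + s = 0 := by
    intro s hs
    have h1 := hF.cone_eq_zero hc (p := s) (q := 1) (by
      simp [jac, qdx, qdy, hb1]
      linear_combination hs)
    simp [cone, qval, hb1] at h1
    linear_combination h1
  obtain ⟨r, s, t, h1, h2, h3⟩ := exists_cubic_roots (b 2 / (2 * b 0)) (b 3 / (4 * b 0))
  have hb2 : b 2 = 2 * b 0 * (r * s + s * t + t * r) := by
    rw [h2]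
    field_simp
  have hb3 : b 3 = -(4 * b 0 * (r * s * t)) := by
    rw [h3]
    field_simp
  have hroot : ∀ z, (z - r) * (z - s) * (z - t) = 0 →
      b 0 * z ^ 4 + b 2 * z ^ 2 + b 3 * z + b 4 + z = 0 := by
    intro z hz
    apply hcrit
    rw [hb2, hb3]
    linear_combination 4 * b 0 * hz + 4 * b 0 * z ^ 2 * h1
  have hr := hroot r (by ring)
  have hs := hroot s (by ring)
  have ht := hroot t (by ring)
  clear hcrit hroot h2 h3
  -- a double critical point at `r`, the third one being `-2 r`
  have hdouble : ∀ r t : ℂ, 2 * r + t = 0 → b 2 = 2 * b 0 * (r * r + r * t + t * r) →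
      b 3 = -(4 * b 0 * (r * r * t)) → b 0 * r ^ 4 + b 2 * r ^ 2 + b 3 * r + b 4 + r = 0 →
      b 0 * t ^ 4 + b 2 * t ^ 2 + b 3 * t + b 4 + t = 0 → F.IsModel := by
    intro r t h1 hb2 hb3 hr ht
    obtain rfl : t = -(2 * r) := by linear_combination h1
    by_cases hr0 : r = 0
    · subst hr0
      obtain ⟨c, hc⟩ := IsAlgClosed.exists_pow_nat_eq (-(b 0)⁻¹) (n := 3) (by norm_num)
      have hc3 : b 0 * c ^ 3 = -1 := by
        rw [hc]
        field_simp
      have hc0 : c ≠ 0 := by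
        rintro rfl
        norm_num at hc3
      obtain ⟨g, hg⟩ := hF.exists_scale_four hc0 ![-1, 0, 0, 0, 0] (by simp [hc3])
        (by simp [hb1]) (by simp [hb2]) (by simp [hb3]) (by
          simp
          linear_combination -hr)
      exact ⟨0, g, hg⟩
    · have h9 : 9 * (b 0 * r ^ 3) = -1 := by
        apply mul_left_cancel₀ hr0
        rw [hb2, hb3] at hr ht
        linear_combination (hr - ht) / 3
      obtain ⟨g, hg⟩ := hF.exists_scale_four hr0 ![-1 / 9, 0, 2 / 3, -8 / 9, -2 / 3]
        (by simp; linear_combination -h9 / 9) (by simp [hb1])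
        (by simp [hb2]; linear_combination (2 / 3) * h9) (by
          simp [hb3]; linear_combination -8 / 9 * h9) (by
          simp
          rw [hb2, hb3] at hr
          linear_combination r / 3 * h9 - hr)
      exact (isModel_of_double hg).of_pullback
  by_cases hrs : r = s
  · subst hrs
    exact hdouble r t (by linear_combination h1) hb2 hb3 hr ht
  by_cases hst : s = t
  · subst hst
    exact hdouble s r (by linear_combination h1) (by rw [hb2]; ring) (by rw [hb3]; ring) hs hr
  by_cases hrt : r = t
  · subst hrt
    exact hdouble r s (by linear_combination h1) (by rw [hb2]; ring) (by rw [hb3]; ring) hr hs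
  -- three distinct critical points: subtracting a multiple of the derivative leaves a quadratic
  -- polynomial with three roots
  have hq : ∀ z, (z - r) * (z - s) * (z - t) = 0 →
      b 0 * z ^ 4 + b 2 * z ^ 2 + b 3 * z + b 4 + z = 0 →
      b 2 / 2 * z ^ 2 + (3 / 4 * b 3 + 1) * z + b 4 = 0 := by
    intro z hz h
    linear_combination h - b 0 * z * hz - b 0 * z ^ 3 * h1 - z ^ 2 / 2 * hb2 - z / 4 * hb3
  obtain ⟨h2, h3, h4⟩ := eq_zero_of_three_roots hrs hst hrt (hq r (by ring) hr)
    (hq s (by ring) hs) (hq t (by ring) ht)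
  have h5 : b 2 = 0 := by linear_combination 2 * h2
  have h6 : b 3 = -4 / 3 := by linear_combination 4 / 3 * h3
  have hr3 : b 0 * r ^ 3 = 1 / 3 := by
    rw [h5, h4, h6] at hr
    rw [h5] at hb2
    have h7 : r * s + s * t + t * r = 0 := by
      apply mul_left_cancel₀ hb0
      linear_combination -hb2 / 2
    have h8 : b 0 * (r * s * t) = 1 / 3 := by linear_combination (hb3 - h6) / 4
    linear_combination h8 + b 0 * r ^ 2 * h1 - b 0 * r * h7
  have hr0 : r ≠ 0 := by
    rintro rfl
    norm_num at hr3
  obtain ⟨g, hg⟩ := hF.exists_scale_four hr0 ![1 / 3, 0, 0, -4 / 3, 0] (by simp [hr3])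
    (by simp [hb1]) (by simp [h5]) (by simp [h6]) (by simp [h4])
  exact (isModel_of_cyclic hg).of_pullback

/-- Maps with a totally ramified fixed point at `[1 : 0]`. -/
theorem isModel_of_order_four {F : Foliation 4} {a b : Fin 5 → ℂ} (hc : F.IsConvex)
    (hF : F.IsCone a b) (h0 : a 0 = 0) (h1 : a 1 = 0) (h2 : a 2 = 0) (h3 : a 3 = 0) :
    F.IsModel := by
  have hb0 := hF.coeff_zero_ne_zero h0
  have ha4 : a 4 ≠ 0 := by
    intro h4
    have h := hF.cone_eq_zero hc (p := 0) (q := 1) (by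
      simp [jac, qdx, qdy, h4, h3])
    simp [cone, qval] at h
    exact hF.coeff_four_ne_zero h4 h
  set c := -b 1 / (4 * b 0) with hcdef
  have hcb : 4 * b 0 * c = -b 1 := by
    rw [hcdef]
    field_simp
  obtain ⟨g, hg⟩ := hF.exists_pullback (k := (a 4)⁻¹) (p := 1) (q := c) (r := 0) (s := 1)
    (a' := ![0, 0, 0, 0, 1])
    (b' := fun j => (a 4)⁻¹ * (![0, 0, 0, 0, c * a 4] j + shift c b j)) (inv_ne_zero ha4)
    (by simp) (fun x y => by simp [qval, h0, h1, h2, h3]; field_simp) (fun x y => by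
      simp [qval, shift, h0, h1, h2, h3]
      ring)
  refine Foliation.IsModel.of_pullback (g := g) (isModel_of_centred (hc.pullback g) hg ?_ ?_)
  · simpa [shift] using ⟨ha4, hb0⟩
  · simp [shift]
    right
    linear_combination hcb

/-- The change of coordinates `(x, y) ↦ (c x, y)`, for a map fixing `[1 : 0]` with order `3`. -/
theorem Foliation.IsCone.exists_scale_three {F : Foliation 4} {b : Fin 5 → ℂ}
    (hF : F.IsCone ![0, 0, 0, 1, 0] b) {c : ℂ} (hc : c ≠ 0) :
    ∃ g : GL (Fin 3) ℂ, (F.pullback g).IsCone ![0, 0, 0, 1, 0]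
      ![b 0 * c ^ 2, b 1 * c, b 2, b 3 / c, b 4 / c ^ 2] := by
  refine hF.exists_pullback (k := (c ^ 2)⁻¹) (p := c) (q := 0) (r := 0) (s := 1)
    (inv_ne_zero (pow_ne_zero _ hc)) (by simpa using hc) (fun x y => ?_) (fun x y => ?_)
  · simp [qval]
    field_simp
  · simp [qval]
    field_simp

/-- The map `x ↦ E (x, 1) / x` with a double critical point at `1`. -/
theorem isModel_of_double_at_one {F : Foliation 4} {b : Fin 5 → ℂ} (hc : F.IsConvex)
    (hF : F.IsCone ![0, 0, 0, 1, 0] b) (h0 : 3 * b 0 + 2 * b 1 + b 2 - b 4 = 0)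
    (h1 : 6 * b 0 + 3 * b 1 + b 2 = 0) : F.IsModel := by
  have hb0 : b 0 ≠ 0 := hF.coeff_zero_ne_zero rfl
  have hb4 : b 4 ≠ 0 := hF.coeff_four_ne_zero rfl
  have hcrit : ∀ s, 3 * b 0 * s ^ 4 + 2 * b 1 * s ^ 3 + b 2 * s ^ 2 - b 4 = 0 →
      b 0 * s ^ 4 + b 1 * s ^ 3 + (b 2 + 1) * s ^ 2 + b 3 * s + b 4 = 0 := by
    intro s hs
    have h1 := hF.cone_eq_zero hc (p := s) (q := 1) (by
      simp [jac, qdx, qdy]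
      linear_combination -4 * hs)
    simp [cone, qval] at h1
    linear_combination h1
  have hV := hcrit 1 (by linear_combination h0)
  -- `e = -b 0` and `m = b 4` parametrise the remaining solutions
  obtain ⟨e, he⟩ : ∃ e, b 0 = -e := ⟨-b 0, by ring⟩
  obtain ⟨m, hm⟩ : ∃ m, b 4 = m := ⟨b 4, rfl⟩
  have hb1 : b 1 = 3 * e - m := by linear_combination h1 - h0 - 3 * he - hm
  have hb2 : b 2 = 3 * m - 3 * e := by linear_combination h1 - 3 * hb1 - 6 * he
  have hb3 : b 3 = e - 1 - 3 * m := by linear_combination hV - he - hb1 - hb2 - hm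
  rw [he] at hb0
  rw [hm] at hb4
  have he0 : e ≠ 0 := fun h => hb0 (by simp [h])
  have hK : ∀ s, 3 * e * s ^ 2 + 2 * m * s + m = 0 → s ≠ 1 →
      (m / 3 - 5 * e) * s + (e - 1 - 13 / 3 * m) = 0 := by
    intro s hs hs1
    have h := hcrit s (by
      rw [he, hb1, hb2, hm]
      linear_combination -(s - 1) ^ 2 * hs)
    have hs0 : s ≠ 0 := by
      rintro rfl
      exact hb4 (by linear_combination hs)
    apply mul_left_cancel₀ hs0
    apply mul_left_cancel₀ (sub_ne_zero.2 hs1)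
    rw [he, hb1, hb2, hb3, hm] at h
    linear_combination -h - (s - 1) * (s / 3 + 1) * hs
  by_cases hme : m = -e
  · -- the critical point `1` is triple
    obtain ⟨g, hg⟩ := hF.exists_pullback (k := 1) (p := 1) (q := 1) (r := 1) (s := 0)
      (a' := ![0, 0, 0, 0, -e]) (b' := ![1, 1, 0, 0, 0]) one_ne_zero (by norm_num) (fun x y => by
        simp [qval, he, hb1, hb2, hb3, hm, hme]
        ring) (fun x y => by
        simp [qval]
        ring)
    exact (isModel_of_order_four (hc.pullback g) hg rfl rfl rfl rfl).of_pullback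
  obtain ⟨r, s, h2, h3⟩ := exists_quadratic_roots (2 * m / (3 * e)) (m / (3 * e))
  have h2' : 3 * e * (r + s) = -(2 * m) := by
    rw [h2]
    field_simp
  have h3' : 3 * e * (r * s) = m := by
    rw [h3]
    field_simp
  have hroot : ∀ z, (z - r) * (z - s) = 0 → 3 * e * z ^ 2 + 2 * m * z + m = 0 := by
    intro z hz
    linear_combination 3 * e * hz + z * h2' - h3'
  have hne : ∀ z, (z - r) * (z - s) = 0 → z ≠ 1 := by
    rintro z hz rfl
    apply hme
    linear_combination (hroot 1 hz) / 3
  have hr := hK r (hroot r (by ring)) (hne r (by ring))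
  have hs := hK s (hroot s (by ring)) (hne s (by ring))
  have hbv : ∀ e' m' : ℂ, e = e' → m = m' →
      b = ![-e', 3 * e' - m', 3 * m' - 3 * e', e' - 1 - 3 * m', m'] := by
    rintro e' m' rfl rfl
    ext j
    fin_cases j
    · exact he
    · exact hb1
    · exact hb2
    · exact hb3
    · exact hm
  by_cases hrs : r = s
  · subst hrs
    have hr0 : r ≠ 0 := by
      rintro rfl
      exact hb4 (by linear_combination -h3')
    have hr1 : r = -1 := by
      have h4 : 3 * e * r * (r + 1) = 0 := by linear_combination h3' + h2' / 2
      rcases mul_eq_zero.1 h4 with h4 | h4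
      · exact absurd h4 (mul_ne_zero (mul_ne_zero (by norm_num) he0) hr0)
      · linear_combination h4
    subst hr1
    have he' : e = -1 / 8 := by linear_combination -(hr - 14 / 3 * h3') / 8
    have hm' : m = -3 / 8 := by linear_combination -h3' + 3 * he'
    rw [hbv _ _ he' hm'] at hF
    refine isModel_of_three_double ?_
    convert hF using 2 <;> norm_num
  · have h4 : m / 3 - 5 * e = 0 := by
      apply mul_left_cancel₀ (sub_ne_zero.2 hrs)
      linear_combination hr - hs
    have h5 : e - 1 - 13 / 3 * m = 0 := by linear_combination hr - r * h4
    have he' : e = -1 / 64 := by linear_combination -(h5 + 13 * h4) / 64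
    have hm' : m = -15 / 64 := by linear_combination 3 * h4 + 15 * he'
    rw [hbv _ _ he' hm'] at hF
    refine isModel_of_two_double ?_
    convert hF using 2 <;> norm_num

/-- Maps with a fixed point of local degree `3` at `[1 : 0]`, whose other preimage is `[0 : 1]`. -/
theorem isModel_of_order_three_aux {F : Foliation 4} {b : Fin 5 → ℂ} (hc : F.IsConvex)
    (hF : F.IsCone ![0, 0, 0, 1, 0] b) : F.IsModel := by
  have hb0 : b 0 ≠ 0 := hF.coeff_zero_ne_zero rfl
  have hb4 : b 4 ≠ 0 := hF.coeff_four_ne_zero rfl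
  by_cases hex : ∃ r, 3 * b 0 * r ^ 4 + 2 * b 1 * r ^ 3 + b 2 * r ^ 2 - b 4 = 0 ∧
      12 * b 0 * r ^ 3 + 6 * b 1 * r ^ 2 + 2 * b 2 * r = 0
  · obtain ⟨r, hr, hr'⟩ := hex
    have hr0 : r ≠ 0 := by
      rintro rfl
      exact hb4 (by linear_combination -hr)
    obtain ⟨g, hg⟩ := hF.exists_scale_three hr0
    refine (isModel_of_double_at_one (hc.pullback g) hg ?_ ?_).of_pullback
    · simp
      field_simp
      linear_combination hr
    · simp
      apply mul_left_cancel₀ hr0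
      linear_combination hr' / 2
  · exfalso
    push Not at hex
    set W : Polynomial ℂ := Polynomial.C (3 * b 0) * Polynomial.X ^ 4
      + Polynomial.C (2 * b 1) * Polynomial.X ^ 3 + Polynomial.C (b 2) * Polynomial.X ^ 2
      + Polynomial.C (-b 4) with hW
    set V : Polynomial ℂ := Polynomial.C (b 1 / 3) * Polynomial.X ^ 3
      + Polynomial.C (2 / 3 * b 2 + 1) * Polynomial.X ^ 2 + Polynomial.C (b 3) * Polynomial.X
      + Polynomial.C (4 / 3 * b 4) with hV
    have hWd : W.degree = 4 := by
      rw [hW]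
      compute_degree!
    have hWe : ∀ r, W.eval r = 3 * b 0 * r ^ 4 + 2 * b 1 * r ^ 3 + b 2 * r ^ 2 - b 4 := by
      intro r
      simp [hW]
      ring
    have hdvd : W ∣ V := by
      refine dvd_of_simple_roots (by rintro h; rw [h] at hWd; simp at hWd) (fun r hr h => ?_)
        fun r hr => ?_
      · refine hex r (by rw [← hWe, hr]) ?_
        rw [← h]
        simp [hW]
        ring
      · rw [hWe] at hr
        have h1 := hF.cone_eq_zero hc (p := r) (q := 1) (by
          simp [jac, qdx, qdy]
          linear_combination -4 * hr)
        simp [cone, qval] at h1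
        simp [hV]
        linear_combination h1 - hr / 3
    have hV0 := Polynomial.eq_zero_of_dvd_of_degree_lt hdvd (by
      rw [hWd, hV]
      have : (Polynomial.C (b 1 / 3) * Polynomial.X ^ 3
        + Polynomial.C (2 / 3 * b 2 + 1) * Polynomial.X ^ 2 + Polynomial.C (b 3) * Polynomial.X
        + Polynomial.C (4 / 3 * b 4) : Polynomial ℂ).degree ≤ 3 := by compute_degree
      exact this.trans_lt (by norm_num))
    have := congrArg (Polynomial.eval 0) hV0
    simp [hV] at this
    exact hb4 this

/-- Maps with a fixed point of local degree at least `3` at `[1 : 0]`. -/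
theorem isModel_of_order_three {F : Foliation 4} {a b : Fin 5 → ℂ} (hc : F.IsConvex)
    (hF : F.IsCone a b) (h0 : a 0 = 0) (h1 : a 1 = 0) (h2 : a 2 = 0) : F.IsModel := by
  by_cases h3 : a 3 = 0
  · exact isModel_of_order_four hc hF h0 h1 h2 h3
  have hca : (-a 4 / a 3) * a 3 = -a 4 := by field_simp
  set c := -a 4 / a 3
  obtain ⟨g, hg⟩ := hF.exists_pullback (k := (a 3)⁻¹) (p := 1) (q := c) (r := 0) (s := 1)
    (a' := ![0, 0, 0, 1, 0])
    (b' := fun j => (a 3)⁻¹ * (c * ![0, 0, 0, a 3, 0] j + shift c b j)) (inv_ne_zero h3)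
    (by simp) (fun x y => by
      simp [qval, h0, h1, h2]
      linear_combination -(x * y ^ 3) * inv_mul_cancel₀ h3 - (a 3)⁻¹ * y ^ 4 * hca) (fun x y => by
      simp [qval, shift, h0, h1, h2]
      linear_combination -(a 3)⁻¹ * c * y ^ 4 * hca)
  exact (isModel_of_order_three_aux (hc.pullback g) hg).of_pullback

/-- The coefficient of `x ^ (6 - k) y ^ k` in the Jacobian determinant of `(A, B)`. -/
def jacCoeff (a b : Fin 5 → ℂ) : Fin 7 → ℂ :=
  ![4 * (a 0 * b 1 - a 1 * b 0), 8 * (a 0 * b 2 - a 2 * b 0),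
    12 * (a 0 * b 3 - a 3 * b 0) + 4 * (a 1 * b 2 - a 2 * b 1),
    16 * (a 0 * b 4 - a 4 * b 0) + 8 * (a 1 * b 3 - a 3 * b 1),
    12 * (a 1 * b 4 - a 4 * b 1) + 4 * (a 2 * b 3 - a 3 * b 2),
    8 * (a 2 * b 4 - a 4 * b 2), 4 * (a 3 * b 4 - a 4 * b 3)]

theorem jac_eq (a b : Fin 5 → ℂ) (p q : ℂ) : jac a b p q =
    jacCoeff a b 0 * p ^ 6 + jacCoeff a b 1 * p ^ 5 * q + jacCoeff a b 2 * p ^ 4 * q ^ 2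
    + jacCoeff a b 3 * p ^ 3 * q ^ 3 + jacCoeff a b 4 * p ^ 2 * q ^ 4
    + jacCoeff a b 5 * p * q ^ 5 + jacCoeff a b 6 * q ^ 6 := by
  simp [jac, qdx, qdy, jacCoeff]
  ring

/-- If the point `[1 : 0]` is critical, then it is fixed and has local degree at least `2`. -/
theorem Foliation.IsCone.coeff_eq_zero {F : Foliation 4} {a b : Fin 5 → ℂ} (hc : F.IsConvex)
    (hF : F.IsCone a b) (h : jacCoeff a b 0 = 0) : a 0 = 0 ∧ a 1 = 0 := by
  have h0 := hF.cone_eq_zero hc (p := 1) (q := 0) (by rw [jac_eq, h]; ring)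
  simp [cone, qval] at h0
  have hb := hF.coeff_zero_ne_zero h0
  simp [jacCoeff, h0] at h
  exact ⟨h0, h.resolve_right hb⟩

/-- A point `[r : 1]` can be moved to `[1 : 0]`. -/
theorem Foliation.IsCone.exists_flip {F : Foliation 4} {a b : Fin 5 → ℂ} (hF : F.IsCone a b)
    (r : ℂ) : ∃ (g : GL (Fin 3) ℂ) (a' b' : Fin 5 → ℂ), (F.pullback g).IsCone a' b' ∧
      jacCoeff a' b' 0 = jac a b r 1 ∧
      jacCoeff a' b' 1 = 6 * jacCoeff a b 0 * r ^ 5 + 5 * jacCoeff a b 1 * r ^ 4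
        + 4 * jacCoeff a b 2 * r ^ 3 + 3 * jacCoeff a b 3 * r ^ 2 + 2 * jacCoeff a b 4 * r
        + jacCoeff a b 5 := by
  obtain ⟨g, hg⟩ := hF.exists_pullback (k := 1) (p := r) (q := 1) (r := 1) (s := 0)
    (a' := fun j => r * flip r a j + flip r b j) (b' := flip r a) one_ne_zero (by simp)
    (fun x y => by
      have h1 := qval_flip r a x y
      have h2 := qval_flip r b x y
      simp only [one_mul, zero_mul, add_zero]
      rw [← h1, ← h2]
      simp only [qval]
      ring) (fun x y => by
      rw [qval_flip]
      ring_nf)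
  refine ⟨g, _, _, hg, ?_, ?_⟩
  · simp [jac, qdx, qdy, jacCoeff, flip, shift]
    ring
  · simp [jacCoeff, flip, shift]
    ring

/-- Maps with a critical point at `[1 : 0]`. -/
theorem isModel_of_order_two {F : Foliation 4} {a b : Fin 5 → ℂ} (hc : F.IsConvex)
    (hF : F.IsCone a b) (h0 : a 0 = 0) (h1 : a 1 = 0) : F.IsModel := by
  by_cases h2 : a 2 = 0
  · exact isModel_of_order_three hc hF h0 h1 h2
  have hb0 := hF.coeff_zero_ne_zero h0
  have hj0 : jacCoeff a b 0 = 0 := by simp [jacCoeff, h0, h1]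
  have hj1 : jacCoeff a b 1 ≠ 0 := by simp [jacCoeff, h0, h2, hb0]
  by_cases hex : ∃ r, jac a b r 1 = 0 ∧ 5 * jacCoeff a b 1 * r ^ 4
        + 4 * jacCoeff a b 2 * r ^ 3 + 3 * jacCoeff a b 3 * r ^ 2 + 2 * jacCoeff a b 4 * r
        + jacCoeff a b 5 = 0
  · obtain ⟨r, hr, hr'⟩ := hex
    obtain ⟨g, a', b', hg, h3, h4⟩ := hF.exists_flip r
    have hc' := hc.pullback g
    rw [hr] at h3
    obtain ⟨h5, h6⟩ := hg.coeff_eq_zero hc' h3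
    rw [hj0, mul_zero, zero_mul, zero_add, hr'] at h4
    have h7 : a' 2 = 0 := by
      simp [jacCoeff, h5] at h4
      exact h4.resolve_right (hg.coeff_zero_ne_zero h5)
    exact (isModel_of_order_three hc' hg h5 h6 h7).of_pullback
  · -- five distinct critical points besides `[1 : 0]`, but only four fixed points
    exfalso
    push Not at hex
    set J : Polynomial ℂ := Polynomial.C (jacCoeff a b 1) * Polynomial.X ^ 5
      + Polynomial.C (jacCoeff a b 2) * Polynomial.X ^ 4
      + Polynomial.C (jacCoeff a b 3) * Polynomial.X ^ 3
      + Polynomial.C (jacCoeff a b 4) * Polynomial.X ^ 2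
      + Polynomial.C (jacCoeff a b 5) * Polynomial.X + Polynomial.C (jacCoeff a b 6) with hJ
    set K : Polynomial ℂ := Polynomial.C (b 0) * Polynomial.X ^ 4
      + Polynomial.C (a 2 + b 1) * Polynomial.X ^ 3 + Polynomial.C (a 3 + b 2) * Polynomial.X ^ 2
      + Polynomial.C (a 4 + b 3) * Polynomial.X + Polynomial.C (b 4) with hK
    have hJd : J.degree = 5 := by
      rw [hJ]
      compute_degree!
    have hJe : ∀ r, J.eval r = jac a b r 1 := by
      intro r
      rw [jac_eq, hj0]
      simp [hJ]
    have hdvd : J ∣ K := by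
      refine dvd_of_simple_roots (by rintro h; rw [h] at hJd; simp at hJd) (fun r hr h => ?_)
        fun r hr => ?_
      · refine hex r (by rw [← hJe, hr]) ?_
        rw [← h]
        simp [hJ]
        ring
      · rw [hJe] at hr
        have h3 := hF.cone_eq_zero hc hr
        simp [cone, qval, h0, h1] at h3
        simp [hK]
        linear_combination h3
    have hK0 := Polynomial.eq_zero_of_dvd_of_degree_lt hdvd (by
      have : K.degree ≤ 4 := by
        rw [hK]
        compute_degree
      rw [hJd]
      exact this.trans_lt (by norm_num))
    have := congrArg (Polynomial.coeff · 4) hK0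
    simp [hK, -map_add] at this
    exact hb0 this

theorem Foliation.IsCone.isModel {F : Foliation 4} {a b : Fin 5 → ℂ} (hF : F.IsCone a b)
    (hc : F.IsConvex) : F.IsModel := by
  by_cases hj0 : jacCoeff a b 0 = 0
  · obtain ⟨h0, h1⟩ := hF.coeff_eq_zero hc hj0
    exact isModel_of_order_two hc hF h0 h1
  · obtain ⟨r, hr⟩ : ∃ r, jac a b r 1 = 0 := by
      set J : Polynomial ℂ := Polynomial.C (jacCoeff a b 0) * Polynomial.X ^ 6
        + Polynomial.C (jacCoeff a b 1) * Polynomial.X ^ 5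
        + Polynomial.C (jacCoeff a b 2) * Polynomial.X ^ 4
        + Polynomial.C (jacCoeff a b 3) * Polynomial.X ^ 3
        + Polynomial.C (jacCoeff a b 4) * Polynomial.X ^ 2
        + Polynomial.C (jacCoeff a b 5) * Polynomial.X + Polynomial.C (jacCoeff a b 6) with hJ
      have hJd : J.degree = 6 := by
        rw [hJ]
        compute_degree!
      obtain ⟨r, hr⟩ := IsAlgClosed.exists_root J (by rw [hJd]; norm_num)
      refine ⟨r, ?_⟩
      rw [jac_eq]
      simpa [Polynomial.IsRoot, hJ] using hr
    obtain ⟨g, a', b', hg, h3, -⟩ := hF.exists_flip r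
    rw [hr] at h3
    obtain ⟨h0, h1⟩ := hg.coeff_eq_zero (hc.pullback g) h3
    exact (isModel_of_order_two (hc.pullback g) hg h0 h1).of_pullback

/-! ### Existence, homogeneity and type of cones -/

/-- Two binary quartics whose ideal contains `x ^ 7` and `y ^ 7` define a cone, unless the tangent
cone vanishes. -/
theorem exists_isCone {a b : Fin 5 → ℂ}
    (h0 : ∃ U V, U * quartic a + V * quartic b = X 0 ^ 7)
    (h1 : ∃ U V, U * quartic a + V * quartic b = X 1 ^ 7)
    (hcone : ∃ p q, cone a b p q ≠ 0) : ∃ F : Foliation 4, F.IsCone a b := by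
  have hX : (X 2 * quartic a).IsHomogeneous (4 + 1) ∧ (X 2 * quartic b).IsHomogeneous (4 + 1) ∧
      (-(X 0 * quartic a + X 1 * quartic b)).IsHomogeneous (4 + 1) :=
    ⟨(isHomogeneous_X ℂ (2 : Fin 3)).mul (isHomogeneous_quartic a),
      (isHomogeneous_X ℂ (2 : Fin 3)).mul (isHomogeneous_quartic b),
      (((isHomogeneous_X ℂ (0 : Fin 3)).mul (isHomogeneous_quartic a)).add
        ((isHomogeneous_X ℂ (1 : Fin 3)).mul (isHomogeneous_quartic b))).neg⟩
  have hab : ∀ π : MvPolynomial (Fin 3) ℂ, Prime π → π ∣ quartic a → π ∣ quartic b → False := by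
    intro π hπ ha hb
    have hd : ∀ i : Fin 3, (∃ U V, U * quartic a + V * quartic b = X i ^ 7) →
        Associated π (X i) := by
      rintro i ⟨U, V, h⟩
      have h7 : π ∣ X i ^ 7 := h ▸ (ha.mul_left U).add (hb.mul_left V)
      exact hπ.associated_of_dvd (X_prime (R := ℂ)) (hπ.dvd_of_dvd_pow h7)
    have := ((hd 0 h0).symm.trans (hd 1 h1)).dvd
    simp [X_dvd_X] at this
  have hC : ¬ (X 2 : MvPolynomial (Fin 3) ℂ) ∣ -(X 0 * quartic a + X 1 * quartic b) := by
    rintro ⟨W, hW⟩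
    obtain ⟨p, q, hpq⟩ := hcone
    apply hpq
    have := congrArg (eval ![p, q, 0]) hW
    simp [eval_quartic] at this
    rw [cone]
    linear_combination -this
  refine ⟨Quotient.mk (formSetoid 4) ⟨![X 2 * quartic a, X 2 * quartic b,
    -(X 0 * quartic a + X 1 * quartic b)], fun i => ?_, ?_, fun P hP => ?_⟩, _, rfl, rfl⟩
  · fin_cases i
    exacts [hX.1, hX.2.1, hX.2.2]
  · rw [Fin.sum_univ_three]
    simp only [Matrix.cons_val]
    ring
  · by_contra hu
    have hP0 : P ≠ 0 := by
      rintro rfl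
      have h2 : -(X 0 * quartic a + X 1 * quartic b) = 0 := zero_dvd_iff.1 (hP 2)
      exact hC (h2 ▸ dvd_zero _)
    obtain ⟨π, hπ, hπP⟩ := WfDvdMonoid.exists_irreducible_factor hu hP0
    have hπ' := hπ.prime
    by_cases hπ2 : π ∣ X 2
    · exact hC (((hπ'.associated_of_dvd (X_prime (R := ℂ)) hπ2).symm.dvd).trans
        (hπP.trans (hP 2)))
    · exact hab π hπ' ((hπ'.dvd_or_dvd (hπP.trans (hP 0))).resolve_left hπ2)
        ((hπ'.dvd_or_dvd (hπP.trans (hP 1))).resolve_left hπ2)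

theorem eq_zero_of_bezout {a b : Fin 5 → ℂ} {p q : ℂ}
    (h0 : ∃ U V, U * quartic a + V * quartic b = X 0 ^ 7)
    (h1 : ∃ U V, U * quartic a + V * quartic b = X 1 ^ 7)
    (ha : qval a p q = 0) (hb : qval b p q = 0) : p = 0 ∧ q = 0 := by
  obtain ⟨U, V, h0⟩ := h0
  obtain ⟨U', V', h1⟩ := h1
  have h0 := congrArg (eval ![p, q, 0]) h0
  have h1 := congrArg (eval ![p, q, 0]) h1
  simp [eval_quartic, ha, hb] at h0 h1
  exact ⟨pow_eq_zero_iff (by norm_num) |>.1 h0.symm, pow_eq_zero_iff (by norm_num) |>.1 h1.symm⟩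

theorem Foliation.IsCone.isHomogeneous {F : Foliation 4} {a b : Fin 5 → ℂ} (hF : F.IsCone a b) :
    F.IsHomogeneous := by
  refine ⟨1, fun l => ?_⟩
  rw [Foliation.pullback_one]
  obtain ⟨ω, rfl, hω⟩ := hF
  refine (mk_eq_mk_iff.2 ⟨(l : ℂ) ^ 5, pow_ne_zero _ l.ne_zero, fun i => ?_⟩).symm
  have hl : (homothety l).val = Matrix.diagonal ![(l : ℂ), l, 1] := rfl
  apply MvPolynomial.funext
  intro v
  have hv : (homothety l).val *ᵥ v = ![l * v 0, l * v 1, v 2] := by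
    rw [hl]
    ext i
    fin_cases i <;> simp [Matrix.mulVec_diagonal]
  simp only [FoliationForm.pullback, pullbackCoeff, eval_add, eval_mul, eval_subst, hv, hω,
    Fin.sum_univ_three, eval_C]
  rw [hl]
  fin_cases i
  · simp [eval_quartic, qval]
    ring
  · simp [eval_quartic, qval]
    ring
  · simp [eval_quartic, qval]
    ring

/-- Convexity of a cone from the factorization of the inflection divisor into powers of five
lines of the tangent cone. -/
theorem Foliation.IsCone.isConvex_of_prod {F : Foliation 4} {a b : Fin 5 → ℂ} (hF : F.IsCone a b)
    {c : ℂ} (hc : c ≠ 0) (l : Fin 5 → ℂ × ℂ) (n : Fin 5 → ℕ) (hl0 : ∀ j, l j ≠ 0)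
    (hl : ∀ j, cone a b (l j).2 (-(l j).1) = 0)
    (h : ∀ p q, cone a b p q * jac a b p q = c * ∏ j, ((l j).1 * p + (l j).2 * q) ^ n j) :
    F.IsConvex := by
  have hmem : ∀ u ∈ ∑ j, Multiset.replicate (n j) (l j), ∃ j, u = l j := by
    intro u hu
    obtain ⟨j, -, hj⟩ := Multiset.mem_sum.1 hu
    exact ⟨j, Multiset.eq_of_mem_replicate hj⟩
  refine hF.isConvex hc (∑ j, Multiset.replicate (n j) (l j)) ?_ ?_ ?_
  · intro u hu
    obtain ⟨j, rfl⟩ := hmem u hu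
    exact hl0 j
  · intro u hu
    obtain ⟨j, rfl⟩ := hmem u hu
    exact hl j
  · intro p q
    rw [h]
    simp [Fin.sum_univ_five, Fin.prod_univ_five]

/-- The type of a convex foliation has no transverse part. -/
theorem Foliation.IsConvex.homType_eq {F : Foliation 4} (h : F.IsConvex) :
    F.homType = Set.ncard {s | F.IsRadialOfOrder s 1} • TypeRing.R 1
      + Set.ncard {s | F.IsRadialOfOrder s 2} • TypeRing.R 2
      + Set.ncard {s | F.IsRadialOfOrder s 3} • TypeRing.R 3 := by
  have hT : ∀ k, k ≠ 0 → Set.ncard {t | F.IsTransverseInflectionLine t k} = 0 := by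
    intro k hk
    convert Set.ncard_empty (ℙ ℂ (Fin 3 → ℂ))
    exact Set.eq_empty_of_forall_notMem fun t => h.not_isTransverseInflectionLine t hk
  rw [Foliation.homType, show Finset.Icc 1 (4 - 1) = {1, 2, 3} by rfl]
  rw [Finset.sum_insert (by decide), Finset.sum_insert (by decide), Finset.sum_singleton,
    hT 1 one_ne_zero, hT 2 two_ne_zero, hT 3 three_ne_zero]
  simp only [zero_smul, add_zero, add_assoc]

/-! ### The five models -/

/-- Bézout identities, which show that the two quartics of a model are coprime. Their cubic
cofactors come from solving a linear system. -/
theorem model_bezout_zero (i : Fin 5) :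
    ∃ U V, U * quartic (modelA i) + V * quartic (modelB i) = X 0 ^ 7 := by
  fin_cases i
  · refine ⟨0, -X 0 ^ 3, MvPolynomial.funext fun v => ?_⟩
    simp [eval_quartic, qval, modelA, modelB]
    ring
  · refine ⟨C (16 / 3) * X 0 ^ 3, X 0 ^ 3 + 2 * X 0 ^ 2 * X 1 + 4 * X 0 * X 1 ^ 2
      - C (8 / 3) * X 1 ^ 3, MvPolynomial.funext fun v => ?_⟩
    simp [eval_quartic, qval, modelA, modelB]
    ring
  · refine ⟨C (256 / 81) * X 0 ^ 3, -X 0 ^ 3 + 4 * X 0 ^ 2 * X 1 + C (80 / 27) * X 0 * X 1 ^ 2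
      + C (64 / 81) * X 1 ^ 3, MvPolynomial.funext fun v => ?_⟩
    simp [eval_quartic, qval, modelA, modelB]
    ring
  · refine ⟨-C (256 / 15) * X 0 ^ 3, X 0 ^ 3 - 4 * X 0 ^ 2 * X 1 + 16 * X 0 * X 1 ^ 2
      + C (64 / 15) * X 1 ^ 3, MvPolynomial.funext fun v => ?_⟩
    simp [eval_quartic, qval, modelA, modelB]
    ring
  · refine ⟨0, C (1 / 3) * X 0 ^ 3, MvPolynomial.funext fun v => ?_⟩
    simp [eval_quartic, qval, modelA, modelB]
    ring

theorem model_bezout_one (i : Fin 5) :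
    ∃ U V, U * quartic (modelA i) + V * quartic (modelB i) = X 1 ^ 7 := by
  fin_cases i
  · refine ⟨X 1 ^ 3, 0, MvPolynomial.funext fun v => ?_⟩
    simp [eval_quartic, qval, modelA, modelB]
    ring
  · refine ⟨C (8 / 3) * X 0 ^ 3 - 4 * X 0 ^ 2 * X 1 - 2 * X 0 * X 1 ^ 2 - X 1 ^ 3,
      -C (16 / 3) * X 1 ^ 3, MvPolynomial.funext fun v => ?_⟩
    simp [eval_quartic, qval, modelA, modelB]
    ring
  · refine ⟨C (224 / 81) * X 0 ^ 3 + 10 * X 0 ^ 2 * X 1 - 4 * X 0 * X 1 ^ 2 + X 1 ^ 3,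
      C (448 / 27) * X 0 * X 1 ^ 2 + C (380 / 81) * X 1 ^ 3, MvPolynomial.funext fun v => ?_⟩
    simp [eval_quartic, qval, modelA, modelB]
    ring
  · refine ⟨C (64 / 15) * X 0 ^ 3 + 16 * X 0 ^ 2 * X 1 - 4 * X 0 * X 1 ^ 2 + X 1 ^ 3,
      -C (256 / 15) * X 1 ^ 3, MvPolynomial.funext fun v => ?_⟩
    simp [eval_quartic, qval, modelA, modelB]
    ring
  · refine ⟨-16 * X 0 ^ 3 + 10 * X 0 ^ 2 * X 1 - 4 * X 0 * X 1 ^ 2 + X 1 ^ 3,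
      32 * X 0 * X 1 ^ 2 + C (4 / 3) * X 1 ^ 3, MvPolynomial.funext fun v => ?_⟩
    simp [eval_quartic, qval, modelA, modelB]
    ring

theorem exists_isCone_model (i : Fin 5) : ∃ F : Foliation 4, F.IsCone (modelA i) (modelB i) := by
  refine exists_isCone (model_bezout_zero i) (model_bezout_one i) ⟨1, 2, ?_⟩
  fin_cases i <;> simp [cone, qval, modelA, modelB] <;> norm_num

theorem eval_dehomogenize (P : MvPolynomial (Fin 3) ℂ) (v : Fin 2 → ℂ) :
    eval v (dehomogenize P) = eval ![v 0, v 1, 1] P := by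
  have : (aeval v).comp dehomogenize = aeval ![v 0, v 1, 1] := by
    apply MvPolynomial.algHom_ext
    intro i
    fin_cases i <;> simp [dehomogenize]
  exact DFunLike.congr_fun this P

theorem Foliation.IsCone.isDescribedBy_omega {F : Foliation 4} {i : Fin 5}
    (hF : F.IsCone (modelA i) (modelB i)) : F.IsDescribedBy (omega i) := by
  obtain ⟨ω, rfl, hω⟩ := hF
  refine ⟨ω, rfl, MvPolynomial.funext fun v => ?_, MvPolynomial.funext fun v => ?_⟩
  · rw [hω, eval_dehomogenize]
    fin_cases i <;> simp [eval_quartic, qval, modelA, omega, x, y] <;> ring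
  · rw [hω, eval_dehomogenize]
    fin_cases i <;> simp [eval_quartic, qval, modelB, omega, x, y] <;> ring

/-- The roots `r` and `s` of a monic quadratic polynomial, its discriminant, and the factorization
of the corresponding binary form. -/
theorem exists_quadratic_factorization (b c : ℂ) : ∃ r s : ℂ,
    r ^ 2 + b * r + c = 0 ∧ s ^ 2 + b * s + c = 0 ∧ (s - r) ^ 2 = b ^ 2 - 4 * c ∧
    ∀ p q, (q - r * p) * (q - s * p) = q ^ 2 + b * (p * q) + c * p ^ 2 := by
  obtain ⟨r, s, h1, h2⟩ := exists_quadratic_roots b c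
  refine ⟨r, s, ?_, ?_, ?_, fun p q => ?_⟩
  · linear_combination r * h1 - h2
  · linear_combination s * h1 - h2
  · linear_combination (r + s - b) * h1 - 4 * h2
  · linear_combination -(p * q) * h1 + p ^ 2 * h2

/-- The tangent cone of each model consists of the two axes, of a line `x - y = 0` or `x + y = 0`,
and of the two lines `y = r x` and `y = s x`. -/
theorem Foliation.IsCone.isConvex_model {F : Foliation 4} {i : Fin 5}
    (hF : F.IsCone (modelA i) (modelB i)) : F.IsConvex := by
  fin_cases i
  · obtain ⟨r, s, hr, hs, -, hf⟩ := exists_quadratic_factorization 1 1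
    refine hF.isConvex_of_prod (c := 16) (by norm_num)
      ![(1, 0), (0, 1), (-1, 1), (-r, 1), (-s, 1)] ![4, 4, 1, 1, 1] ?_ ?_ ?_
    · intro j
      fin_cases j <;> simp
    · intro j
      fin_cases j <;> simp [cone, qval, modelA, modelB]
      · linear_combination r * (r - 1) * hr
      · linear_combination s * (s - 1) * hs
    · intro p q
      simp [cone, qval, jac, qdx, qdy, modelA, modelB, Fin.prod_univ_five]
      linear_combination (-16 * p ^ 4 * q ^ 4 * (q - p)) * hf p q
  · obtain ⟨r, s, hr, hs, -, hf⟩ := exists_quadratic_factorization (-1) 1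
    refine hF.isConvex_of_prod (c := 24) (by norm_num)
      ![(1, 0), (0, 1), (-1, 1), (-r, 1), (-s, 1)] ![3, 3, 3, 1, 1] ?_ ?_ ?_
    · intro j
      fin_cases j <;> simp
    · intro j
      fin_cases j <;> simp [cone, qval, modelA, modelB]
      · linear_combination r * (1 - r) * hr
      · linear_combination s * (1 - s) * hs
    · intro p q
      simp [cone, qval, jac, qdx, qdy, modelA, modelB, Fin.prod_univ_five]
      linear_combination (-24 * p ^ 3 * q ^ 3 * (q - p) ^ 3) * hf p q
  · obtain ⟨r, s, hr, hs, -, hf⟩ := exists_quadratic_factorization 3 (-1)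
    refine hF.isConvex_of_prod (c := 48) (by norm_num)
      ![(1, 0), (0, 1), (1, 1), (-r, 1), (-s, 1)] ![3, 2, 4, 1, 1] ?_ ?_ ?_
    · intro j
      fin_cases j <;> simp
    · intro j
      fin_cases j <;> simp [cone, qval, modelA, modelB]
      · norm_num
      · linear_combination r * (1 + r) * hr
      · linear_combination s * (1 + s) * hs
    · intro p q
      simp [cone, qval, jac, qdx, qdy, modelA, modelB, Fin.prod_univ_five]
      linear_combination (-48 * p ^ 3 * q ^ 2 * (p + q) ^ 4) * hf p q
  · obtain ⟨r, s, hr, hs, -, hf⟩ := exists_quadratic_factorization 3 1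
    refine hF.isConvex_of_prod (c := -48) (by norm_num)
      ![(1, 0), (0, 1), (1, 1), (-r, 1), (-s, 1)] ![3, 3, 1, 2, 2] ?_ ?_ ?_
    · intro j
      fin_cases j <;> simp
    · intro j
      fin_cases j <;> simp [cone, qval, modelA, modelB]
      · norm_num
      · linear_combination r * (1 + r) * hr
      · linear_combination s * (1 + s) * hs
    · intro p q
      simp [cone, qval, jac, qdx, qdy, modelA, modelB, Fin.prod_univ_five]
      linear_combination (48 * p ^ 3 * q ^ 3 * (p + q)
        * ((q - r * p) * (q - s * p) + q ^ 2 + 3 * (p * q) + p ^ 2)) * hf p q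
  · obtain ⟨r, s, hr, hs, -, hf⟩ := exists_quadratic_factorization 3 3
    refine hF.isConvex_of_prod (c := -48) (by norm_num)
      ![(1, 0), (0, 1), (1, 1), (-r, 1), (-s, 1)] ![4, 2, 1, 2, 2] ?_ ?_ ?_
    · intro j
      fin_cases j <;> simp
    · intro j
      fin_cases j <;> simp [cone, qval, modelA, modelB]
      · norm_num
      · linear_combination r * (1 + r) * hr
      · linear_combination s * (1 + s) * hs
    · intro p q
      simp [cone, qval, jac, qdx, qdy, modelA, modelB, Fin.prod_univ_five]
      linear_combination (-48 * p ^ 4 * q ^ 2 * (p + q)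
        * ((q - r * p) * (q - s * p) + q ^ 2 + 3 * (p * q) + 3 * p ^ 2)) * hf p q

/-- The radial singularities of the models are the multiple fixed points listed in each case; where
`r` and `s` occur, they are the two simple critical points. -/
theorem Foliation.IsCone.ncard_isRadialOfOrder_model {F : Foliation 4} {i : Fin 5}
    (hF : F.IsCone (modelA i) (modelB i)) :
    Set.ncard {s | F.IsRadialOfOrder s 1} = ![0, 0, 1, 2, 3] i ∧
    Set.ncard {s | F.IsRadialOfOrder s 2} = ![0, 3, 1, 2, 0] i ∧
    Set.ncard {s | F.IsRadialOfOrder s 3} = ![2, 0, 1, 0, 1] i := by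
  have hcop : ∀ p q, qval (modelA i) p q = 0 → qval (modelB i) p q = 0 → p = 0 ∧ q = 0 :=
    fun p q => eq_zero_of_bezout (model_bezout_zero i) (model_bezout_one i)
  fin_cases i
  · have key := fun k hk => hF.ncard_isRadialOfOrder hcop (n := 2) ![(1, 0), (0, 1)]
      ![3, 3]
      (by intro j; fin_cases j <;> simp)
      (by intro i j; fin_cases i <;> fin_cases j <;> simp)
      (by
        intro j
        fin_cases j
        · refine ⟨1, MvPolynomial.funext fun v => ?_,
            fun c hc => ?_⟩
          · simp [eval_quartic, qval, modelA, modelB, linForm_eq_sum]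
            ring
          · simp
        · refine ⟨-1, MvPolynomial.funext fun v => ?_,
            fun c hc => ?_⟩
          · simp [eval_quartic, qval, modelA, modelB, linForm_eq_sum]
          · simp)
      (by
        intro p q h1 h2
        simp [qdx, qdy, modelA, modelB] at h1 h2
        rcases h1 with rfl | rfl
        · exact ⟨0, p, by simp⟩
        · exact ⟨1, q, by simp⟩) (k := k) hk
    exact ⟨key 1 (by norm_num), key 2 (by norm_num), key 3 (by norm_num)⟩
  · have key := fun k hk => hF.ncard_isRadialOfOrder hcop (n := 3) ![(1, 0), (0, 1), (1, 1)]
      ![2, 2, 2]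
      (by intro j; fin_cases j <;> simp)
      (by intro i j; fin_cases i <;> fin_cases j <;> simp)
      (by
        intro j
        fin_cases j
        · refine ⟨X 1 - 2 * X 0, MvPolynomial.funext fun v => ?_,
            fun c hc => ?_⟩
          · simp [eval_quartic, qval, modelA, modelB, linForm_eq_sum]
            ring
          · simp [hc]
        · refine ⟨X 0 - 2 * X 1, MvPolynomial.funext fun v => ?_,
            fun c hc => ?_⟩
          · simp [eval_quartic, qval, modelA, modelB, linForm_eq_sum]
            ring
          · simp [hc]
        · refine ⟨X 0 + X 1, MvPolynomial.funext fun v => ?_,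
            fun c hc => ?_⟩
          · simp [eval_quartic, qval, modelA, modelB, linForm_eq_sum]
            ring
          · simpa [← two_mul] using hc)
      (by
        intro p q h1 h2
        simp [qdx, qdy, modelA, modelB] at h1 h2
        have e1 : p * q * (q - p) * (q - 2 * p) = 0 := by linear_combination h1 / 2
        have e2 : p * q * (q - p) * (2 * q - p) = 0 := by linear_combination -h2 / 2
        have h : p * q * (q - p) = 0 := by
          by_contra hne
          have e3 := (mul_eq_zero.1 e1).resolve_left hne
          have e4 := (mul_eq_zero.1 e2).resolve_left hne
          apply hne
          rw [show p = 0 by linear_combination (e4 - 2 * e3) / 3]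
          ring
        rcases mul_eq_zero.1 h with h | h
        · rcases mul_eq_zero.1 h with rfl | rfl
          · exact ⟨1, q, by simp⟩
          · exact ⟨0, p, by simp⟩
        · exact ⟨2, p, by simp, by simp; linear_combination h⟩) (k := k) hk
    exact ⟨key 1 (by norm_num), key 2 (by norm_num), key 3 (by norm_num)⟩
  · have key := fun k hk => hF.ncard_isRadialOfOrder hcop (n := 3) ![(1, 0), (0, 1), (1, -1)]
      ![1, 2, 3]
      (by intro j; fin_cases j <;> simp)
      (by intro i j; fin_cases i <;> fin_cases j <;> simp)
      (by
        intro j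
        fin_cases j
        · refine ⟨6 * X 0 ^ 2 + 4 * X 0 * X 1 + X 1 ^ 2, MvPolynomial.funext fun v => ?_,
            fun c hc => ?_⟩
          · simp [eval_quartic, qval, modelA, modelB, linForm_eq_sum]
            ring
          · simp [hc]
        · refine ⟨-(X 0 + 4 * X 1), MvPolynomial.funext fun v => ?_,
            fun c hc => ?_⟩
          · simp [eval_quartic, qval, modelA, modelB, linForm_eq_sum]
            ring
          · simp [hc]
        · refine ⟨1, MvPolynomial.funext fun v => ?_,
            fun c hc => ?_⟩
          · simp [eval_quartic, qval, modelA, modelB, linForm_eq_sum]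
            ring
          · simp)
      (by
        intro p q h1 h2
        simp [qdx, qdy, modelA, modelB] at h1 h2
        have e1 : p * q * (p + q) * (q - p) = 0 := by linear_combination h1 / 4
        have e2 : p * q * (p + q) * (2 * p + q) = 0 := by linear_combination h2 / 4
        have h : p * q * (p + q) = 0 := by
          by_contra hne
          have e3 := (mul_eq_zero.1 e1).resolve_left hne
          have e4 := (mul_eq_zero.1 e2).resolve_left hne
          apply hne
          rw [show p = 0 by linear_combination (e4 - e3) / 3]
          ring
        rcases mul_eq_zero.1 h with h | h
        · rcases mul_eq_zero.1 h with rfl | rfl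
          · exact ⟨1, q, by simp⟩
          · exact ⟨0, p, by simp⟩
        · exact ⟨2, p, by simp, by simp; linear_combination h⟩) (k := k) hk
    exact ⟨key 1 (by norm_num), key 2 (by norm_num), key 3 (by norm_num)⟩
  · obtain ⟨r, s, hr, hs, hd, hf⟩ := exists_quadratic_factorization 3 1
    have hrs : r ≠ s := by
      rintro rfl
      norm_num at hd
    have hr0 : r ≠ 0 := by
      rintro rfl
      norm_num at hr
    have hs0 : s ≠ 0 := by
      rintro rfl
      norm_num at hs
    have key := fun k hk => hF.ncard_isRadialOfOrder hcop (n := 4)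
      ![(1, 0), (0, 1), (1, r), (1, s)] ![2, 2, 1, 1]
      (by intro j; fin_cases j <;> simp)
      (by intro i j; fin_cases i <;> fin_cases j <;> simp [sub_eq_zero, hrs, hrs.symm, hr0, hs0])
      (by
        intro j
        fin_cases j
        · refine ⟨-(X 1 + 4 * X 0), MvPolynomial.funext fun v => ?_,
            fun c hc => ?_⟩
          · simp [eval_quartic, qval, modelA, modelB, linForm_eq_sum]
            ring
          · simp [hc]
        · refine ⟨X 0 + 4 * X 1, MvPolynomial.funext fun v => ?_,
            fun c hc => ?_⟩
          · simp [eval_quartic, qval, modelA, modelB, linForm_eq_sum]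
            ring
          · simp [hc]
        -- the quotient of `A + r B` by `(y - r x) ^ 2`, reduced by the equation of `r`
        · refine ⟨X 1 ^ 2 + C (4 + 2 * r) * X 0 * X 1 - C (r + 3) * X 0 ^ 2,
            MvPolynomial.funext fun v => ?_, fun c hc => ?_⟩
          · simp [eval_quartic, qval, modelA, modelB, linForm_eq_sum]
            linear_combination (3 * v 0 ^ 2 * v 1 ^ 2 - 2 * r * v 0 ^ 3 * v 1 + r * v 0 ^ 4) * hr
          · intro h0
            simp at h0
            have h3 : c ^ 2 * (r + 1) = 0 := by linear_combination c ^ 2 / 2 * hr - h0 / 6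
            have h4 : r = -1 := by
              linear_combination (mul_eq_zero.1 h3).resolve_left (pow_ne_zero 2 hc)
            norm_num [h4] at hr
        · refine ⟨X 1 ^ 2 + C (4 + 2 * s) * X 0 * X 1 - C (s + 3) * X 0 ^ 2,
            MvPolynomial.funext fun v => ?_, fun c hc => ?_⟩
          · simp [eval_quartic, qval, modelA, modelB, linForm_eq_sum]
            linear_combination (3 * v 0 ^ 2 * v 1 ^ 2 - 2 * s * v 0 ^ 3 * v 1 + s * v 0 ^ 4) * hs
          · intro h0
            simp at h0
            have h3 : c ^ 2 * (s + 1) = 0 := by linear_combination c ^ 2 / 2 * hs - h0 / 6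
            have h4 : s = -1 := by
              linear_combination (mul_eq_zero.1 h3).resolve_left (pow_ne_zero 2 hc)
            norm_num [h4] at hs)
      (by
        intro p q h1 h2
        simp [qdx, qdy, modelA, modelB] at h1 h2
        have h : p * q * ((q - r * p) * (q - s * p)) = 0 := by
          rw [hf]
          linear_combination h1 / 4
        rcases mul_eq_zero.1 h with h | h
        · rcases mul_eq_zero.1 h with rfl | rfl
          · exact ⟨1, q, by simp⟩
          · exact ⟨0, p, by simp⟩
        · rcases mul_eq_zero.1 h with h | h
          · exact ⟨2, p, by simp, by simp; linear_combination h⟩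
          · exact ⟨3, p, by simp, by simp; linear_combination h⟩) (k := k) hk
    exact ⟨key 1 (by norm_num), key 2 (by norm_num), key 3 (by norm_num)⟩
  · obtain ⟨r, s, hr, hs, hd, hf⟩ := exists_quadratic_factorization 3 3
    have hrs : r ≠ s := by
      rintro rfl
      norm_num at hd
    have hr0 : r ≠ 0 := by
      rintro rfl
      norm_num at hr
    have hs0 : s ≠ 0 := by
      rintro rfl
      norm_num at hs
    have key := fun k hk => hF.ncard_isRadialOfOrder hcop (n := 4)
      ![(1, 0), (0, 1), (1, r), (1, s)] ![1, 3, 1, 1]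
      (by intro j; fin_cases j <;> simp)
      (by intro i j; fin_cases i <;> fin_cases j <;> simp [sub_eq_zero, hrs, hrs.symm, hr0, hs0])
      (by
        intro j
        fin_cases j
        · refine ⟨6 * X 0 ^ 2 + 4 * X 0 * X 1 + X 1 ^ 2, MvPolynomial.funext fun v => ?_,
            fun c hc => ?_⟩
          · simp [eval_quartic, qval, modelA, modelB, linForm_eq_sum]
            ring
          · simp [hc]
        · refine ⟨3, MvPolynomial.funext fun v => ?_,
            fun c hc => ?_⟩
          · simp [eval_quartic, qval, modelA, modelB, linForm_eq_sum]
            ring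
          · simp
        -- the quotient of `A + r B` by `(y - r x) ^ 2`, reduced by the equation of `r`
        · refine ⟨X 1 ^ 2 + C (4 + 2 * r) * X 0 * X 1 - C (r + 3) * X 0 ^ 2,
            MvPolynomial.funext fun v => ?_, fun c hc => ?_⟩
          · simp [eval_quartic, qval, modelA, modelB, linForm_eq_sum]
            linear_combination (3 * v 0 ^ 2 * v 1 ^ 2 - 2 * r * v 0 ^ 3 * v 1 + r * v 0 ^ 4) * hr
          · intro h0
            simp at h0
            have h3 : c ^ 2 * (r + 2) = 0 := by linear_combination c ^ 2 / 2 * hr - h0 / 6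
            have h4 : r = -2 := by
              linear_combination (mul_eq_zero.1 h3).resolve_left (pow_ne_zero 2 hc)
            norm_num [h4] at hr
        · refine ⟨X 1 ^ 2 + C (4 + 2 * s) * X 0 * X 1 - C (s + 3) * X 0 ^ 2,
            MvPolynomial.funext fun v => ?_, fun c hc => ?_⟩
          · simp [eval_quartic, qval, modelA, modelB, linForm_eq_sum]
            linear_combination (3 * v 0 ^ 2 * v 1 ^ 2 - 2 * s * v 0 ^ 3 * v 1 + s * v 0 ^ 4) * hs
          · intro h0
            simp at h0
            have h3 : c ^ 2 * (s + 2) = 0 := by linear_combination c ^ 2 / 2 * hs - h0 / 6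
            have h4 : s = -2 := by
              linear_combination (mul_eq_zero.1 h3).resolve_left (pow_ne_zero 2 hc)
            norm_num [h4] at hs)
      (by
        intro p q h1 h2
        simp [qdx, qdy, modelA, modelB] at h1 h2
        have h : p * q * ((q - r * p) * (q - s * p)) = 0 := by
          rw [hf]
          linear_combination h1 / 4
        rcases mul_eq_zero.1 h with h | h
        · rcases mul_eq_zero.1 h with rfl | rfl
          · exact ⟨1, q, by simp⟩
          · exact ⟨0, p, by simp⟩
        · rcases mul_eq_zero.1 h with h | h
          · exact ⟨2, p, by simp, by simp; linear_combination h⟩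
          · exact ⟨3, p, by simp, by simp; linear_combination h⟩) (k := k) hk
    exact ⟨key 1 (by norm_num), key 2 (by norm_num), key 3 (by norm_num)⟩

theorem Foliation.IsCone.homType_model {F : Foliation 4} {i : Fin 5}
    (hF : F.IsCone (modelA i) (modelB i)) : F.homType = omegaType i := by
  obtain ⟨h1, h2, h3⟩ := hF.ncard_isRadialOfOrder_model
  rw [hF.isConvex_model.homType_eq, h1, h2, h3]
  fin_cases i <;> simp [omegaType]

end PlaneFoliation

theorem theoremA :
    ∃ H : Fin 5 → PlaneFoliation.Foliation 4,
      (∀ i, (H i).IsDescribedBy (PlaneFoliation.omega i)) ∧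
      (∀ i, (H i).IsHomogeneous ∧ (H i).IsConvex) ∧
      (∀ i, (H i).homType = PlaneFoliation.omegaType i) ∧
      (∀ i j, i ≠ j → ¬ (H i).IsConjugate (H j)) ∧
      (∀ F : PlaneFoliation.Foliation 4, F.IsHomogeneous → F.IsConvex →
        ∃ i, (H i).IsConjugate F) := by
  choose H hH using PlaneFoliation.exists_isCone_model
  refine ⟨H, fun i => (hH i).isDescribedBy_omega,
    fun i => ⟨(hH i).isHomogeneous, (hH i).isConvex_model⟩, fun i => (hH i).homType_model, ?_, ?_⟩
  · intro i j hij h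
    obtain ⟨hi, -, hi'⟩ := (hH i).ncard_isRadialOfOrder_model
    obtain ⟨hj, -, hj'⟩ := (hH j).ncard_isRadialOfOrder_model
    have h1 := h.ncard_isRadialOfOrder 1
    have h3 := h.ncard_isRadialOfOrder 3
    rw [hi, hj] at h1
    rw [hi', hj'] at h3
    revert hij h1 h3
    clear hi hj hi' hj' h
    revert i j
    decide
  · intro F hF hc
    obtain ⟨g, a, b, hg⟩ := hF.exists_isCone
    obtain ⟨i, g', hg'⟩ := (hg.isModel (hc.pullback g)).of_pullback
    exact ⟨i, PlaneFoliation.Foliation.IsConjugate.symm ⟨g', (hH i).unique hg'⟩⟩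

end
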